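/- Let $N\ge 3$ and $n\ge 2$, let $\Omega\subset\mathbb R^N$ be a bounded open set, let $a_1,\dots,a_n\in\Omega$ be pairwise distinct points, and put $$V(x)=\sum_{1\le i<j\le n}\frac{|a_i-a_j|^2}{|x-a_i|^2|x-a_j|^2}.$$ Let $D^{1,2}(\Omega)$ be the completion of $C_0^\infty(\Omega)$ (smooth functions with compact support in $\Omega$) with respect to the norm $\big(\int_\Omega|\nabla u|^2\,dx\big)^{1/2}$, realised as a space of functions in $L^{2N/(N-2)}(\Omega)$ with weak gradient in $L^2(\Omega)$, let $H^1_0(\Omega)$ be the closure of $C_0^\infty(\Omega)$ in $H^1(\Omega)$, and let $$\mu^\star(\Omega)=\inf_{u\in D^{1,2}(\Omega)\setminus\{0\}}\frac{\int_\Omega|\nabla u|^2\,dx}{\int_\Omega Vu^2\,dx}.$$ Then $\int_\Omega Vu^2\,dx<\infty$ for all $u\in C_0^\infty(\Omega)$, and the following hold. (i) For every real $\mu<\frac{(N-2)^2}{4n-4}$ there is a finite constant $c_\mu\in\mathbb R$ (depending on $\Omega$ and $a_1,\dots,a_n$) such that $$c_\mu\int_\Omega u^2\,dx+\int_\Omega|\nabla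 u|^2\,dx\ \ge\ \mu\int_\Omega Vu^2\,dx\qquad\text{for all }u\in C_0^\infty(\Omega).$$ (ii) For every $\mu>\frac{(N-2)^2}{4n-4}$ and every $\lambda\in\mathbb R$ there is $u_{\lambda,\mu}\in C_0^\infty(\Omega)$ such that $$\lambda\int_\Omega u_{\lambda,\mu}^2\,dx+\int_\Omega|\nabla u_{\lambda,\mu}|^2\,dx\ <\ \mu\int_\Omega Vu_{\lambda,\mu}^2\,dx.$$ Consequently the weak Hardy constant, that is, the supremum of all $\mu>0$ for which there is $c\in\mathbb R$ with $\int_\Omega|\nabla u|^2\,dx-\mu\int_\Omega Vu^2\,dx\ge c\int_\Omega u^2\,dx$ for all $u\in C_0^\infty(\Omega)$, equals $\frac{(N-2)^2}{4n-4}$. (iii) If $\mu^\star(\Omega)<\frac{(N-2)^2}{4n-4}$, then $\mu^\star(\Omega)$ is attained in $H^1_0(\Omega)$: there is $u\in H^1_0(\Omega)\setminus\{0\}$ with $\int_\Omega|\nabla u|^2\,dx\big/\int_\Omega Vu^2\,dx=\mu^\star(\Omega)$. (iv) If $n=2$, then $\mu^\star(\Omega)$ is not attained by any $u\in D^{1,2}(\Omega)\setminus\{0\}$.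 -/

import Mathlib

open MeasureTheory Filter Topology TopologicalSpace
open scoped ENNReal Distributions Gradient

namespace MultipolarHardy

noncomputable section

/-- The potential `V(x) = ∑_{i<j} |a_i - a_j|² / (|x - a_i|² |x - a_j|²)` with poles `a_1, …, a_n`.
(Its value at the poles themselves, a null set, is irrelevant.) -/
def potential {N n : ℕ} (a : Fin n → EuclideanSpace ℝ (Fin N)) (x : EuclideanSpace ℝ (Fin N)) : ℝ :=
  ∑ i, ∑ j ∈ Finset.Ioi i, ‖a i - a j‖ ^ 2 / (‖x - a i‖ ^ 2 * ‖x - a j‖ ^ 2)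

/-- `u ∈ L^p(Ω)` and `g ∈ L²(Ω; ℝ^N)` are the limits, in `L^p(Ω)` and `L²(Ω; ℝ^N)` respectively, of
`φ_k` and of `∇φ_k` for one sequence `φ_k ∈ C_0^∞(Ω)`. Then `g` is the weak gradient of `u`.
Only the values of `u` and `g` on `Ω` matter. -/
structure MemClosure {N : ℕ} (p : ℝ≥0∞) (Ω : Opens (EuclideanSpace ℝ (Fin N)))
    (u : EuclideanSpace ℝ (Fin N) → ℝ)
    (g : EuclideanSpace ℝ (Fin N) → EuclideanSpace ℝ (Fin N)) : Prop where
  memLp : MemLp u p (volume.restrict (Ω : Set (EuclideanSpace ℝ (Fin N))))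
  memLp_grad : MemLp g 2 (volume.restrict (Ω : Set (EuclideanSpace ℝ (Fin N))))
  approx : ∃ φ : ℕ → 𝓓(Ω, ℝ),
    Tendsto (fun k => eLpNorm (fun x => φ k x - u x) p
      (volume.restrict (Ω : Set (EuclideanSpace ℝ (Fin N))))) atTop (𝓝 0) ∧
    Tendsto (fun k => eLpNorm (fun x => ∇ (φ k : EuclideanSpace ℝ (Fin N) → ℝ) x - g x) 2
      (volume.restrict (Ω : Set (EuclideanSpace ℝ (Fin N))))) atTop (𝓝 0)

/-- `u ∈ H¹₀(Ω)`, with weak gradient `g`: the closure of `C_0^∞(Ω)` in the `H¹(Ω)` norm. -/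
def MemH10 {N : ℕ} (Ω : Opens (EuclideanSpace ℝ (Fin N)))
    (u : EuclideanSpace ℝ (Fin N) → ℝ)
    (g : EuclideanSpace ℝ (Fin N) → EuclideanSpace ℝ (Fin N)) : Prop :=
  MemClosure 2 Ω u g

/-- `u ∈ D^{1,2}(Ω)`, with weak gradient `g`, in dimension `N ≥ 3`: the completion of `C_0^∞(Ω)`
with respect to the `L²` norm of the gradient. By the Sobolev inequality a sequence of test
functions that is Cauchy for this norm converges in `L^{2N/(N-2)}`, and the completion is realised
as the space of these limits. -/
def MemD12 {N : ℕ} (Ω : Opens (EuclideanSpace ℝ (Fin N)))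
    (u : EuclideanSpace ℝ (Fin N) → ℝ)
    (g : EuclideanSpace ℝ (Fin N) → EuclideanSpace ℝ (Fin N)) : Prop :=
  MemClosure (ENNReal.ofReal (2 * N / (N - 2))) Ω u g

/-- The quotient `∫_Ω |g|² / ∫_Ω V u²`, the integrals being those of nonnegative functions. -/
def hardyQuotient {N n : ℕ} (a : Fin n → EuclideanSpace ℝ (Fin N))
    (Ω : Opens (EuclideanSpace ℝ (Fin N))) (u : EuclideanSpace ℝ (Fin N) → ℝ)
    (g : EuclideanSpace ℝ (Fin N) → EuclideanSpace ℝ (Fin N)) : ℝ≥0∞ :=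
  (∫⁻ x in Ω, ENNReal.ofReal (‖g x‖ ^ 2)) / ∫⁻ x in Ω, ENNReal.ofReal (potential a x * u x ^ 2)

/-- The optimal constant `μ*(Ω)`: the infimum of `∫_Ω |∇u|² / ∫_Ω V u²` over the nonzero
`u ∈ D^{1,2}(Ω)`. -/
def hardyConstant {N n : ℕ} (a : Fin n → EuclideanSpace ℝ (Fin N))
    (Ω : Opens (EuclideanSpace ℝ (Fin N))) : ℝ≥0∞ :=
  sInf {q | ∃ u g, MemD12 Ω u g ∧
    ¬ u =ᵐ[volume.restrict (Ω : Set (EuclideanSpace ℝ (Fin N)))] 0 ∧ q = hardyQuotient a Ω u g}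

/-- The parameters `μ > 0` for which `-Δ - μ V` is bounded below on `C_0^∞(Ω)`. The weak Hardy
constant is the supremum of this set. -/
def weakHardyParameters {N n : ℕ} (a : Fin n → EuclideanSpace ℝ (Fin N))
    (Ω : Opens (EuclideanSpace ℝ (Fin N))) : Set ℝ :=
  {μ | 0 < μ ∧ ∃ c : ℝ, ∀ u : 𝓓(Ω, ℝ),
    (∫ x in Ω, ‖∇ (u : EuclideanSpace ℝ (Fin N) → ℝ) x‖ ^ 2)
      - μ * ∫ x in Ω, potential a x * u x ^ 2 ≥ c * ∫ x in Ω, u x ^ 2}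

end

end MultipolarHardy

/-! ### The inversion field and its divergence -/

namespace MultipolarHardy

noncomputable section

variable {N : ℕ}

/-! Put `Y = ∑ᵢ (x - aᵢ) / |x - aᵢ|²` and `S = ∑ᵢ |x - aᵢ|⁻²`. Then `div Y = (N - 2) S`, and since
each term of `V` is a squared distance `|Xᵢ - Xⱼ|²` between the summands of `Y`, `V = n S - |Y|²`
(`potential_eq`). For any field `F`, expanding `∫ |∇u + u F|² ≥ 0` gives `∫ (div F - |F|²) u² ≤ ∫
|∇u|²` (`integral_field_le`). Every Hardy-type bound below is a choice of `F`.

With `F = αY` and `α = (N - 2) / n`, `div F - |F|² = α² V`: this is the whole-space inequality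
`multipolar_hardy`. With `α = (N - 2) / 2` the left side is `2α² S - α² |Y|²`. Near a pole `|Y|²` is
comparable to `S` with ratio 1, so `|Y|² ≤ (1 + δ) S + C`, and this dominates `μ V - C'` exactly
when `μ (n - 1) < α²` (`weak_hardy`).

The threshold is sharp because near one pole `V` behaves like `(n - 1) / |x - aᵢ|²`, while the
one-pole constant `(N - 2)² / 4` is optimal on functions concentrated there (`exists_concentrated`,
`exists_lt_above_threshold`).

Attainment below the threshold: for a normalised minimising sequence, the nonnegative form `∫ |∇u|²
- μ* ∫ V u²` and the parallelogram law make this form small on differences. Rellich's theorem makes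
the `L²` norm of differences small, and the weak inequality with some `μ` between `μ*` and the
threshold absorbs `μ* ∫ V u²`. The sequence is therefore Cauchy in the gradient norm and converges
strongly to a minimiser (`exists_minimizer`).

For `n = 2` the whole-space constant equals the threshold, so equality would have to hold in
`multipolar_hardy`. Adding to `F` a small multiple of `⟨e, x - a₀⟩^(2N+1) e`, with `e` orthogonal to
the line of the poles, leaves a remainder whose weight is positive off a hyperplane, so a minimiser
must vanish (`exists_two_pole_hardy_remainder`, `not_attained_two_poles`). -/

/-- The inversion `(x - a) / |x - a|²` with pole `a`. -/
def inversion (a x : EuclideanSpace ℝ (Fin N)) : EuclideanSpace ℝ (Fin N) :=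
  (‖x - a‖ ^ 2)⁻¹ • (x - a)

lemma norm_inversion (a x : EuclideanSpace ℝ (Fin N)) : ‖inversion a x‖ = ‖x - a‖⁻¹ := by
  rw [inversion, norm_smul, norm_inv, norm_pow, norm_norm, sq, mul_inv, mul_assoc]
  by_cases h : ‖x - a‖ = 0
  · simp [h]
  · rw [inv_mul_cancel₀ h, mul_one]

lemma measurable_inversion (a : EuclideanSpace ℝ (Fin N)) : Measurable (inversion a) := by
  unfold inversion; fun_prop

lemma integrable_inv_norm_sq_mul (hN : 3 ≤ N) (a : EuclideanSpace ℝ (Fin N))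
    {g : EuclideanSpace ℝ (Fin N) → ℝ} (hg : Continuous g) (hg' : HasCompactSupport g) :
    Integrable (fun x => (‖x - a‖ ^ 2)⁻¹ * g x) := by
  have h1 : LocallyIntegrable (fun x : EuclideanSpace ℝ (Fin N) => (‖x‖ ^ 2)⁻¹) := by
    -- The singularity has order 2, below the dimension: this is where `3 ≤ N` enters.
    refine locallyIntegrable_of_norm_le_rpow (C := 1) (α := 2) ?_ ?_ ?_ ?_
    · simp; omega
    · simp; norm_cast
    · refine Eventually.of_forall fun x => ?_
      rw [one_mul, Real.rpow_neg (norm_nonneg _)]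
      simp
    · exact (by fun_prop : Measurable fun x : EuclideanSpace ℝ (Fin N) =>
        (‖x‖ ^ 2)⁻¹).aestronglyMeasurable
  have h2 := h1.integrable_smul_right_of_hasCompactSupport (g := fun x => g (x + a))
    (by fun_prop) (hg'.comp_homeomorph (Homeomorph.addRight a))
  simpa using h2.comp_sub_right a

lemma integrable_inv_norm_mul (hN : 3 ≤ N) (a : EuclideanSpace ℝ (Fin N))
    {g : EuclideanSpace ℝ (Fin N) → ℝ} (hg : Continuous g) (hg' : HasCompactSupport g) :
    Integrable (fun x => ‖x - a‖⁻¹ * g x) := by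
  have h1 := (integrable_inv_norm_sq_mul hN a hg hg').norm
  have h2 := (hg.integrable_of_hasCompactSupport hg' (μ := volume)).norm
  refine (h1.add h2).mono' (by
    have : Measurable g := hg.measurable
    exact (by fun_prop : Measurable _).aestronglyMeasurable) ?_
  refine Eventually.of_forall fun x => ?_
  have h3 : ‖x - a‖⁻¹ ≤ (‖x - a‖ ^ 2)⁻¹ + 1 := by
    rw [← inv_pow]; nlinarith [sq_nonneg (‖x - a‖⁻¹ - 1), inv_nonneg.2 (norm_nonneg (x - a))]
  simp only [Pi.add_apply, norm_mul, norm_inv, norm_pow, norm_norm]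
  calc _ ≤ ((‖x - a‖ ^ 2)⁻¹ + 1) * ‖g x‖ := by gcongr
    _ = _ := by ring

/-- Integration by parts against the regularised inversion field. -/
lemma integral_regularized_div (a : EuclideanSpace ℝ (Fin N)) {ε : ℝ} (hε : 0 < ε)
    {v : EuclideanSpace ℝ (Fin N) → ℝ} (hv : ContDiff ℝ 1 v) (hv' : HasCompactSupport v) :
    ∫ x, v x * (N * (‖x - a‖ ^ 2 + ε)⁻¹ - 2 * ‖x - a‖ ^ 2 * ((‖x - a‖ ^ 2 + ε)⁻¹) ^ 2) =
      - ∫ x, fderiv ℝ v x (x - a) * (‖x - a‖ ^ 2 + ε)⁻¹ := by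
  have hpos : ∀ x : EuclideanSpace ℝ (Fin N), ‖x - a‖ ^ 2 + ε ≠ 0 := fun x => by positivity
  set f : Fin N → EuclideanSpace ℝ (Fin N) → ℝ := fun i x => (x i - a i) * (‖x - a‖ ^ 2 + ε)⁻¹
    with hf
  set b : Fin N → EuclideanSpace ℝ (Fin N) := fun i => EuclideanSpace.single i 1 with hb
  have hfC : ∀ i, ContDiff ℝ 1 (f i) := fun i => by
    refine ContDiff.mul (by fun_prop) (ContDiff.inv ?_ hpos)
    exact ((contDiff_id.sub contDiff_const).norm_sq ℝ).add contDiff_const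
  have hfd : ∀ i x, fderiv ℝ (f i) x (b i) = (‖x - a‖ ^ 2 + ε)⁻¹ -
      2 * (x i - a i) ^ 2 * ((‖x - a‖ ^ 2 + ε)⁻¹) ^ 2 := by
    intro i x
    have h1 : HasFDerivAt (fun x : EuclideanSpace ℝ (Fin N) => ‖x - a‖ ^ 2 + ε)
        (2 • (innerSL ℝ (x - a))) x := by
      have := ((hasFDerivAt_id x).sub_const a).norm_sq.add_const ε
      simpa using this
    have h2 : HasFDerivAt (fun x : EuclideanSpace ℝ (Fin N) => x i - a i)
        (EuclideanSpace.proj i : EuclideanSpace ℝ (Fin N) →L[ℝ] ℝ) x :=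
      ((EuclideanSpace.proj i : EuclideanSpace ℝ (Fin N) →L[ℝ] ℝ).hasFDerivAt).sub_const (a i)
    have h3 : HasFDerivAt (f i) _ x := h2.mul ((hasDerivAt_inv (hpos x)).comp_hasFDerivAt x h1)
    rw [h3.fderiv]
    simp [hb, EuclideanSpace.inner_single_right]
    ring
  have hvd : Continuous (fderiv ℝ v) := hv.continuous_fderiv (by simp)
  have key : ∀ i, ∫ x, v x * fderiv ℝ (f i) x (b i) = - ∫ x, fderiv ℝ v x (b i) * f i x := by
    intro i
    have c1 : Continuous (f i) := (hfC i).continuous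
    have c2 : Continuous (fderiv ℝ (f i)) := (hfC i).continuous_fderiv (by simp)
    have c3 := hv.continuous
    refine integral_mul_fderiv_eq_neg_fderiv_mul_of_integrable ?_ ?_ ?_ ?_ ?_
    · refine Continuous.integrable_of_hasCompactSupport (by fun_prop) ?_
      exact ((hv'.fderiv ℝ).comp_left (g := fun L : _ →L[ℝ] ℝ => L (b i)) (by simp)).mul_right
    · exact Continuous.integrable_of_hasCompactSupport (by fun_prop) hv'.mul_right
    · exact Continuous.integrable_of_hasCompactSupport (by fun_prop) hv'.mul_right
    · exact fun x _ => (hv.differentiable (by simp)) x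
    · exact fun x _ => ((hfC i).differentiable (by simp)) x
  have e1 : ∀ x, v x * (N * (‖x - a‖ ^ 2 + ε)⁻¹ - 2 * ‖x - a‖ ^ 2 * ((‖x - a‖ ^ 2 + ε)⁻¹) ^ 2) =
      ∑ i, v x * fderiv ℝ (f i) x (b i) := by
    intro x
    rw [← Finset.mul_sum]
    simp_rw [hfd]
    rw [Finset.sum_sub_distrib, ← Finset.sum_mul, ← Finset.mul_sum,
      EuclideanSpace.norm_sq_eq (x - a)]
    simp
  have e2 : ∀ x, fderiv ℝ v x (x - a) * (‖x - a‖ ^ 2 + ε)⁻¹ =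
      ∑ i, fderiv ℝ v x (b i) * f i x := by
    intro x
    have : x - a = ∑ i, (x i - a i) • b i := by
      have := (EuclideanSpace.basisFun (Fin N) ℝ).sum_repr (x - a)
      simpa [hb] using this.symm
    conv_lhs => rw [this]
    simp only [map_sum, map_smul, smul_eq_mul, hf, Finset.sum_mul]
    refine Finset.sum_congr rfl fun i _ => ?_
    rw [← this]; ring
  simp_rw [e1, e2]
  rw [integral_finsetSum, integral_finsetSum, Finset.sum_congr rfl fun i _ => key i,
    Finset.sum_neg_distrib]
  · intro i _
    have c1 : Continuous (f i) := (hfC i).continuous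
    refine Continuous.integrable_of_hasCompactSupport (by fun_prop) ?_
    exact ((hv'.fderiv ℝ).comp_left (g := fun L : _ →L[ℝ] ℝ => L (b i)) (by simp)).mul_right
  · intro i _
    have c2 : Continuous (fderiv ℝ (f i)) := (hfC i).continuous_fderiv (by simp)
    have c3 := hv.continuous
    exact Continuous.integrable_of_hasCompactSupport (by fun_prop) hv'.mul_right

/-- The divergence of the inversion field is `(N - 2) / |x - a|²`. -/
lemma integral_div_inversion (hN : 3 ≤ N) (a : EuclideanSpace ℝ (Fin N))
    {v : EuclideanSpace ℝ (Fin N) → ℝ} (hv : ContDiff ℝ 1 v) (hv' : HasCompactSupport v) :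
    ∫ x, ((N : ℝ) - 2) * (‖x - a‖ ^ 2)⁻¹ * v x = - ∫ x, fderiv ℝ v x (inversion a x) := by
  set ε : ℕ → ℝ := fun k => 1 / ((k : ℝ) + 1) with hε
  have hεpos : ∀ k, 0 < ε k := fun k => by positivity
  have hεlim : Tendsto ε atTop (𝓝 0) := tendsto_one_div_add_atTop_nhds_zero_nat
  have hvc := hv.continuous
  have hvd : Continuous (fderiv ℝ v) := hv.continuous_fderiv (by simp)
  have hN0 : Nontrivial (EuclideanSpace ℝ (Fin N)) := by
    have : Nonempty (Fin N) := ⟨⟨0, by omega⟩⟩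
    infer_instance
  have hane : ∀ᵐ x : EuclideanSpace ℝ (Fin N), x ≠ a := by
    simp [ae_iff, measure_singleton]
  have hinv : ∀ x, x ≠ a → Tendsto (fun k => (‖x - a‖ ^ 2 + ε k)⁻¹) atTop (𝓝 (‖x - a‖ ^ 2)⁻¹) := by
    intro x hx
    have : ‖x - a‖ ^ 2 ≠ 0 := by simp [sub_eq_zero, hx]
    have h := (tendsto_const_nhds (x := ‖x - a‖ ^ 2)).add hεlim
    rw [add_zero] at h
    exact h.inv₀ this
  have hle : ∀ k x, x ≠ a → (‖x - a‖ ^ 2 + ε k)⁻¹ ≤ (‖x - a‖ ^ 2)⁻¹ := by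
    intro k x hx
    have : 0 < ‖x - a‖ ^ 2 := by have := sub_ne_zero.2 hx; positivity
    have := hεpos k
    gcongr; linarith
  -- Both sides of the regularised identity pass to the limit by dominated convergence; the bound
  -- `r² (r² + ε)⁻¹ ≤ 1` gives majorants of order `r⁻²` here and `r⁻¹` in `L2`.
  have L1 : Tendsto (fun k => ∫ x, v x * (N * (‖x - a‖ ^ 2 + ε k)⁻¹ -
      2 * ‖x - a‖ ^ 2 * ((‖x - a‖ ^ 2 + ε k)⁻¹) ^ 2)) atTop
      (𝓝 (∫ x, ((N : ℝ) - 2) * (‖x - a‖ ^ 2)⁻¹ * v x)) := by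
    refine tendsto_integral_of_dominated_convergence
      (fun x => (N + 2) * ‖(‖x - a‖ ^ 2)⁻¹ * v x‖) ?_ ?_ ?_ ?_
    · intro k
      have := hvc.measurable
      exact (by fun_prop : Measurable _).aestronglyMeasurable
    · exact (integrable_inv_norm_sq_mul hN a hvc hv').norm.const_mul _
    · intro k
      filter_upwards [hane] with x hx
      have h1 := hle k x hx
      have h0 : 0 < (‖x - a‖ ^ 2 + ε k)⁻¹ := by have := hεpos k; positivity
      have h2 : ‖x - a‖ ^ 2 * (‖x - a‖ ^ 2 + ε k)⁻¹ ≤ 1 := by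
        have := hεpos k
        rw [← div_eq_mul_inv, div_le_one (by positivity)]; linarith
      rw [norm_mul, norm_mul, Real.norm_eq_abs, Real.norm_eq_abs, Real.norm_eq_abs,
        abs_of_nonneg (a := (‖x - a‖ ^ 2)⁻¹) (by positivity),
        show ((N : ℝ) + 2) * ((‖x - a‖ ^ 2)⁻¹ * |v x|) = |v x| * ((N + 2) * (‖x - a‖ ^ 2)⁻¹) by ring]
      refine mul_le_mul_of_nonneg_left ?_ (abs_nonneg _)
      set y := (‖x - a‖ ^ 2 + ε k)⁻¹
      set z := (‖x - a‖ ^ 2)⁻¹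
      have e : 2 * ‖x - a‖ ^ 2 * y ^ 2 = 2 * (‖x - a‖ ^ 2 * y) * y := by ring
      have h3 : 0 ≤ ‖x - a‖ ^ 2 * y := by positivity
      have hn0 : (0 : ℝ) ≤ N := by positivity
      rw [e, abs_le]
      constructor <;> nlinarith [mul_le_mul_of_nonneg_right h2 h0.le]
    · filter_upwards [hane] with x hx
      have h := hinv x hx
      have h2 : ‖x - a‖ ^ 2 ≠ 0 := by simp [sub_eq_zero, hx]
      have : ((N : ℝ) - 2) * (‖x - a‖ ^ 2)⁻¹ * v x = v x * (N * (‖x - a‖ ^ 2)⁻¹ -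
          2 * ‖x - a‖ ^ 2 * ((‖x - a‖ ^ 2)⁻¹) ^ 2) := by field_simp
      rw [this]
      exact ((h.const_mul _).sub ((h.pow 2).const_mul _)).const_mul _
  have L2 : Tendsto (fun k => ∫ x, fderiv ℝ v x (x - a) * (‖x - a‖ ^ 2 + ε k)⁻¹) atTop
      (𝓝 (∫ x, fderiv ℝ v x (inversion a x))) := by
    refine tendsto_integral_of_dominated_convergence
      (fun x => ‖x - a‖⁻¹ * ‖fderiv ℝ v x‖) ?_ ?_ ?_ ?_
    · intro k
      have h1 : Continuous fun x => fderiv ℝ v x (x - a) := by fun_prop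
      exact (h1.measurable.mul (by fun_prop)).aestronglyMeasurable
    · exact integrable_inv_norm_mul hN a hvd.norm (hv'.fderiv ℝ).norm
    · intro k
      filter_upwards [hane] with x hx
      have h1 := hle k x hx
      have h0 : 0 < (‖x - a‖ ^ 2 + ε k)⁻¹ := by have := hεpos k; positivity
      have h2 : 0 < ‖x - a‖ := by have := sub_ne_zero.2 hx; positivity
      rw [norm_mul, Real.norm_eq_abs (_⁻¹), abs_of_pos h0]
      calc _ ≤ ‖fderiv ℝ v x‖ * ‖x - a‖ * (‖x - a‖ ^ 2)⁻¹ := by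
            gcongr; exact (fderiv ℝ v x).le_opNorm _
        _ = _ := by field_simp
    · filter_upwards [hane] with x hx
      rw [inversion, map_smul, smul_eq_mul, mul_comm]
      exact (hinv x hx).const_mul _
  have e : ∀ k, _ := fun k => integral_regularized_div a (hεpos k) hv hv'
  simp_rw [e] at L1
  exact tendsto_nhds_unique L1 L2.neg

end

end MultipolarHardy

/-! ### The field inequality and the identity `V = n S - |Y|²` -/

namespace MultipolarHardy

noncomputable section

variable {N : ℕ}

lemma continuous_gradient {u : EuclideanSpace ℝ (Fin N) → ℝ} (hu : ContDiff ℝ 1 u) :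
    Continuous (∇ u) := by
  have h : Continuous (fderiv ℝ u) := hu.continuous_fderiv (by simp)
  exact (InnerProductSpace.toDual ℝ (EuclideanSpace ℝ (Fin N))).symm.continuous.comp h

lemma hasCompactSupport_gradient {u : EuclideanSpace ℝ (Fin N) → ℝ} (hu : HasCompactSupport u) :
    HasCompactSupport (∇ u) := by
  have h : HasCompactSupport (fderiv ℝ u) := hu.fderiv ℝ
  exact h.comp_left (g := (InnerProductSpace.toDual ℝ (EuclideanSpace ℝ (Fin N))).symm) (by simp)

lemma integrable_norm_gradient_sq {u : EuclideanSpace ℝ (Fin N) → ℝ} (hu : ContDiff ℝ 1 u)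
    (hu' : HasCompactSupport u) : Integrable (fun x => ‖∇ u x‖ ^ 2) := by
  refine Continuous.integrable_of_hasCompactSupport ((continuous_gradient hu).norm.pow 2) ?_
  exact (hasCompactSupport_gradient hu').comp_left (g := fun y => ‖y‖ ^ 2) (by simp)

lemma hasCompactSupport_sq {u : EuclideanSpace ℝ (Fin N) → ℝ} (hu' : HasCompactSupport u) :
    HasCompactSupport (fun x => u x ^ 2) :=
  hu'.comp_left (g := fun y : ℝ => y ^ 2) (by simp)

lemma fderiv_sq_apply {u : EuclideanSpace ℝ (Fin N) → ℝ} (hu : ContDiff ℝ 1 u)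
    (x y : EuclideanSpace ℝ (Fin N)) :
    fderiv ℝ (fun x => u x ^ 2) x y = 2 * u x * inner ℝ (∇ u x) y := by
  have hd : DifferentiableAt ℝ u x := hu.differentiable (by simp) x
  rw [inner_gradient_left, (hd.hasFDerivAt.pow 2).fderiv]
  simp

/-- If `D` is the divergence of the field `F` tested against `u²`, then
`∫ (D - |F|²) u² ≤ ∫ |∇u|²`. -/
lemma integral_field_le {u : EuclideanSpace ℝ (Fin N) → ℝ} (hu : ContDiff ℝ 1 u)
    (hu' : HasCompactSupport u) {F : EuclideanSpace ℝ (Fin N) → EuclideanSpace ℝ (Fin N)}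
    {D : EuclideanSpace ℝ (Fin N) → ℝ} (hF : Measurable F)
    (hDu : Integrable (fun x => D x * u x ^ 2)) (hFu : Integrable (fun x => ‖F x‖ ^ 2 * u x ^ 2))
    (hdiv : ∫ x, D x * u x ^ 2 = - ∫ x, fderiv ℝ (fun x => u x ^ 2) x (F x)) :
    ∫ x, (D x - ‖F x‖ ^ 2) * u x ^ 2 ≤ ∫ x, ‖∇ u x‖ ^ 2 := by
  have hG := integrable_norm_gradient_sq hu hu'
  have hum : Measurable u := hu.continuous.measurable
  have hgm : Measurable (∇ u) := (continuous_gradient hu).measurable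
  have hc : Integrable (fun x => fderiv ℝ (fun x => u x ^ 2) x (F x)) := by
    simp_rw [fderiv_sq_apply hu]
    refine (hG.add hFu).mono' ?_ (Eventually.of_forall fun x => ?_)
    · exact ((by fun_prop : Measurable fun x => 2 * u x).mul
        (hgm.inner hF)).aestronglyMeasurable
    · have h1 := abs_real_inner_le_norm (∇ u x) (F x)
      rw [Real.norm_eq_abs, abs_mul, abs_mul, abs_two, Pi.add_apply, ← sq_abs (u x)]
      calc _ ≤ 2 * |u x| * (‖∇ u x‖ * ‖F x‖) := by gcongr
        _ ≤ _ := by nlinarith [sq_nonneg (‖∇ u x‖ - ‖F x‖ * |u x|)]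
  -- The whole inequality is the expansion of this square: its cross term is `F · ∇(u²)`, which
  -- integrates to minus the divergence term.
  have h0 : 0 ≤ ∫ x, ‖∇ u x + u x • F x‖ ^ 2 := integral_nonneg fun x => by positivity
  have he : ∀ x, ‖∇ u x + u x • F x‖ ^ 2 =
      ‖∇ u x‖ ^ 2 + fderiv ℝ (fun x => u x ^ 2) x (F x) + ‖F x‖ ^ 2 * u x ^ 2 := by
    intro x
    rw [norm_add_sq_real, fderiv_sq_apply hu, inner_smul_right, norm_smul, mul_pow,
      Real.norm_eq_abs, sq_abs]
    ring
  simp_rw [he] at h0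
  have hGc : Integrable (fun x => ‖∇ u x‖ ^ 2 + fderiv ℝ (fun x => u x ^ 2) x (F x)) := hG.add hc
  rw [integral_add hGc hFu, integral_add hG hc] at h0
  simp_rw [sub_mul]
  rw [integral_sub hDu hFu, hdiv]
  linarith

variable {n : ℕ}

lemma ae_notMem_range (hN : 3 ≤ N) (a : Fin n → EuclideanSpace ℝ (Fin N)) :
    ∀ᵐ x : EuclideanSpace ℝ (Fin N), ∀ i, x ≠ a i := by
  have hN0 : Nontrivial (EuclideanSpace ℝ (Fin N)) := by
    have : Nonempty (Fin N) := ⟨⟨0, by omega⟩⟩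
    infer_instance
  rw [ae_all_iff]
  intro i
  simp [ae_iff, measure_singleton]

/-- A crude Cauchy–Schwarz bound, used only for integrability. The bound that decides the threshold
is `exists_norm_sum_inversion_sq_le`. -/
lemma norm_sum_inversion_sq_le (a : Fin n → EuclideanSpace ℝ (Fin N))
    (x : EuclideanSpace ℝ (Fin N)) :
    ‖∑ i, inversion (a i) x‖ ^ 2 ≤ n * ∑ i, (‖x - a i‖ ^ 2)⁻¹ := by
  calc ‖∑ i, inversion (a i) x‖ ^ 2 ≤ (∑ i, ‖inversion (a i) x‖) ^ 2 := by
        gcongr; exact norm_sum_le _ _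
    _ ≤ n * ∑ i, ‖inversion (a i) x‖ ^ 2 := by
        simpa using sq_sum_le_card_mul_sum_sq (s := Finset.univ)
          (f := fun i => ‖inversion (a i) x‖)
    _ = _ := by simp_rw [norm_inversion, inv_pow]

lemma integrable_sum_inv_norm_sq_mul (hN : 3 ≤ N) (a : Fin n → EuclideanSpace ℝ (Fin N))
    {g : EuclideanSpace ℝ (Fin N) → ℝ} (hg : Continuous g) (hg' : HasCompactSupport g) :
    Integrable (fun x => (∑ i, (‖x - a i‖ ^ 2)⁻¹) * g x) := by
  simp_rw [Finset.sum_mul]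
  exact integrable_finsetSum _ fun i _ => integrable_inv_norm_sq_mul hN (a i) hg hg'

/-- As `e` is a unit vector, `(k + 1) ⟨e, x - p⟩^k` is the divergence of `⟨e, x - p⟩^(k+1) e`, the
perturbation used for two poles. -/
lemma integral_inner_pow_div (e p : EuclideanSpace ℝ (Fin N)) (he : ‖e‖ = 1) (k : ℕ)
    {v : EuclideanSpace ℝ (Fin N) → ℝ} (hv : ContDiff ℝ 1 v) (hv' : HasCompactSupport v) :
    ∫ x, (k + 1) * inner ℝ e (x - p) ^ k * v x =
      - ∫ x, inner ℝ e (x - p) ^ (k + 1) * fderiv ℝ v x e := by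
  have hvd : Continuous (fderiv ℝ v) := hv.continuous_fderiv (by simp)
  have hvc := hv.continuous
  have hfC : ContDiff ℝ 1 (fun x : EuclideanSpace ℝ (Fin N) => inner ℝ e (x - p) ^ (k + 1)) :=
    ((contDiff_const).inner ℝ (contDiff_id.sub contDiff_const)).pow _
  have hfd : ∀ x, fderiv ℝ (fun x : EuclideanSpace ℝ (Fin N) => inner ℝ e (x - p) ^ (k + 1)) x e =
      (k + 1) * inner ℝ e (x - p) ^ k := by
    intro x
    have h1 : HasFDerivAt (fun x : EuclideanSpace ℝ (Fin N) => inner ℝ e (x - p))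
        (innerSL ℝ e) x := by
      have := (innerSL ℝ e).hasFDerivAt.comp x ((hasFDerivAt_id x).sub_const p)
      rw [ContinuousLinearMap.comp_id] at this
      exact this
    rw [(h1.pow (k + 1)).fderiv]
    simp [he]
  have := integral_mul_fderiv_eq_neg_fderiv_mul_of_integrable (μ := volume) (v := e) (f := v)
    (g := fun x : EuclideanSpace ℝ (Fin N) => inner ℝ e (x - p) ^ (k + 1)) ?_ ?_ ?_ ?_ ?_
  · simp_rw [hfd] at this
    rw [integral_congr_ae (Eventually.of_forall fun x => mul_comm _ (v x)), this]
    simp_rw [mul_comm]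
  · refine Continuous.integrable_of_hasCompactSupport (by fun_prop) ?_
    exact ((hv'.fderiv ℝ).comp_left (g := fun L : _ →L[ℝ] ℝ => L e) (by simp)).mul_right
  · simp_rw [hfd]
    exact Continuous.integrable_of_hasCompactSupport (by fun_prop) hv'.mul_right
  · exact Continuous.integrable_of_hasCompactSupport (by fun_prop) hv'.mul_right
  · exact fun x _ => (hv.differentiable (by simp)) x
  · exact fun x _ => (hfC.differentiable (by simp)) x

/-- The field inequality for `F = α ∑ᵢ (x - aᵢ) / |x - aᵢ|² + δ ⟨e, x - p⟩^(k+1) e`. -/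
lemma integral_inversion_field_le (hN : 3 ≤ N) (a : Fin n → EuclideanSpace ℝ (Fin N))
    (α δ : ℝ) (k : ℕ) (e p : EuclideanSpace ℝ (Fin N)) (he : ‖e‖ = 1)
    {u : EuclideanSpace ℝ (Fin N) → ℝ} (hu : ContDiff ℝ 1 u) (hu' : HasCompactSupport u) :
    Integrable (fun x => (α * (N - 2) * (∑ i, (‖x - a i‖ ^ 2)⁻¹) +
      δ * ((k + 1) * inner ℝ e (x - p) ^ k) -
      ‖α • ∑ i, inversion (a i) x + (δ * inner ℝ e (x - p) ^ (k + 1)) • e‖ ^ 2) * u x ^ 2) ∧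
    ∫ x, (α * (N - 2) * (∑ i, (‖x - a i‖ ^ 2)⁻¹) + δ * ((k + 1) * inner ℝ e (x - p) ^ k) -
      ‖α • ∑ i, inversion (a i) x + (δ * inner ℝ e (x - p) ^ (k + 1)) • e‖ ^ 2) * u x ^ 2 ≤
    ∫ x, ‖∇ u x‖ ^ 2 := by
  set v : EuclideanSpace ℝ (Fin N) → ℝ := fun x => u x ^ 2 with hv_def
  have hv : ContDiff ℝ 1 v := hu.pow 2
  have hv' : HasCompactSupport v := hasCompactSupport_sq hu'
  have hvc := hv.continuous
  have hvm := hvc.measurable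
  have hvd : Continuous (fderiv ℝ v) := hv.continuous_fderiv (by simp)
  have hS := integrable_sum_inv_norm_sq_mul hN a hvc hv'
  have hYm : Measurable (fun x => ∑ i, inversion (a i) x) :=
    Finset.measurable_sum _ fun i _ => measurable_inversion (a i)
  have hFm : Measurable (fun x : EuclideanSpace ℝ (Fin N) => α • ∑ i, inversion (a i) x +
      (δ * inner ℝ e (x - p) ^ (k + 1)) • e) :=
    (hYm.const_smul α).add (by fun_prop : Continuous _).measurable
  have hI1 : Integrable (fun x => δ * ((k + 1) * inner ℝ e (x - p) ^ k) * v x) :=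
    Continuous.integrable_of_hasCompactSupport (by fun_prop) hv'.mul_left
  have hD : Integrable (fun x => (α * (N - 2) * (∑ i, (‖x - a i‖ ^ 2)⁻¹) +
      δ * ((k + 1) * inner ℝ e (x - p) ^ k)) * v x) := by
    refine ((hS.const_mul (α * (N - 2))).add hI1).congr (Eventually.of_forall fun x => ?_)
    simp only [Pi.add_apply]; ring
  have hFI : Integrable (fun x => ‖α • ∑ i, inversion (a i) x +
      (δ * inner ℝ e (x - p) ^ (k + 1)) • e‖ ^ 2 * v x) := by
    have h2 : Integrable (fun x => 2 * (δ * inner ℝ e (x - p) ^ (k + 1)) ^ 2 * v x) :=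
      Continuous.integrable_of_hasCompactSupport (by fun_prop) hv'.mul_left
    refine ((hS.const_mul (2 * α ^ 2 * n)).add h2).mono' ?_ (Eventually.of_forall fun x => ?_)
    · exact ((hFm.norm.pow_const 2).mul hvm).aestronglyMeasurable
    · have hv0 : 0 ≤ v x := sq_nonneg _
      have h1 := norm_sum_inversion_sq_le a x
      rw [Real.norm_eq_abs, abs_of_nonneg (by positivity), Pi.add_apply]
      have h3 : ‖α • ∑ i, inversion (a i) x + (δ * inner ℝ e (x - p) ^ (k + 1)) • e‖ ^ 2 ≤
          2 * α ^ 2 * (n * ∑ i, (‖x - a i‖ ^ 2)⁻¹) +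
            2 * (δ * inner ℝ e (x - p) ^ (k + 1)) ^ 2 := by
        have h4 := norm_add_le (α • ∑ i, inversion (a i) x)
          ((δ * inner ℝ e (x - p) ^ (k + 1)) • e)
        have h5 := pow_le_pow_left₀ (norm_nonneg _) h4 2
        rw [norm_smul, norm_smul, he, mul_one] at h5
        have h6 : (‖α‖ * ‖∑ i, inversion (a i) x‖) ^ 2 = α ^ 2 * ‖∑ i, inversion (a i) x‖ ^ 2 := by
          rw [mul_pow, Real.norm_eq_abs, sq_abs]
        have h7 : ‖δ * inner ℝ e (x - p) ^ (k + 1)‖ ^ 2 =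
          (δ * inner ℝ e (x - p) ^ (k + 1)) ^ 2 := by rw [Real.norm_eq_abs, sq_abs]
        have h8 := mul_le_mul_of_nonneg_left h1 (by positivity : 0 ≤ 2 * α ^ 2)
        nlinarith [sq_nonneg (‖α‖ * ‖∑ i, inversion (a i) x‖ -
          ‖δ * inner ℝ e (x - p) ^ (k + 1)‖)]
      calc _ ≤ (2 * α ^ 2 * (n * ∑ i, (‖x - a i‖ ^ 2)⁻¹) +
            2 * (δ * inner ℝ e (x - p) ^ (k + 1)) ^ 2) * v x := by gcongr
        _ = _ := by ring
  have hinvI : ∀ i, Integrable (fun x => fderiv ℝ v x (inversion (a i) x)) := by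
    intro i
    refine (integrable_inv_norm_mul hN (a i) hvd.norm (hv'.fderiv ℝ).norm).mono' ?_
      (Eventually.of_forall fun x => ?_)
    · have h1 : Measurable (fun x => inner ℝ (∇ v x) (inversion (a i) x)) :=
        (continuous_gradient hv).measurable.inner (measurable_inversion _)
      simpa [inner_gradient_left] using h1.aestronglyMeasurable
    · rw [← norm_inversion, mul_comm]
      exact (fderiv ℝ v x).le_opNorm _
  have hlinI : Integrable (fun x => inner ℝ e (x - p) ^ (k + 1) * fderiv ℝ v x e) := by
    refine Continuous.integrable_of_hasCompactSupport (by fun_prop) ?_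
    exact ((hv'.fderiv ℝ).comp_left (g := fun L : _ →L[ℝ] ℝ => L e) (by simp)).mul_left
  have hdiv : ∫ x, (α * (N - 2) * (∑ i, (‖x - a i‖ ^ 2)⁻¹) +
      δ * ((k + 1) * inner ℝ e (x - p) ^ k)) * v x =
      - ∫ x, fderiv ℝ v x (α • ∑ i, inversion (a i) x +
        (δ * inner ℝ e (x - p) ^ (k + 1)) • e) := by
    have e1 : ∀ x, (α * (N - 2) * (∑ i, (‖x - a i‖ ^ 2)⁻¹) +
      δ * ((k + 1) * inner ℝ e (x - p) ^ k)) * v x =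
        α * ∑ i, ((N : ℝ) - 2) * (‖x - a i‖ ^ 2)⁻¹ * v x +
          δ * ((k + 1) * inner ℝ e (x - p) ^ k * v x) := by
      intro x
      rw [← Finset.sum_mul, ← Finset.mul_sum]; ring
    have e2 : ∀ x, fderiv ℝ v x (α • ∑ i, inversion (a i) x +
        (δ * inner ℝ e (x - p) ^ (k + 1)) • e) = α * ∑ i, fderiv ℝ v x (inversion (a i) x) +
        δ * (inner ℝ e (x - p) ^ (k + 1) * fderiv ℝ v x e) := by
      intro x
      simp only [map_add, map_smul, map_sum, smul_eq_mul, mul_assoc]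
    have hJ : ∀ i ∈ (Finset.univ : Finset (Fin n)),
        Integrable (fun x => ((N : ℝ) - 2) * (‖x - a i‖ ^ 2)⁻¹ * v x) := by
      intro i _
      simpa [mul_assoc] using (integrable_inv_norm_sq_mul hN (a i) hvc hv').const_mul ((N : ℝ) - 2)
    simp_rw [e1, e2]
    rw [integral_add, integral_add, integral_const_mul, integral_const_mul, integral_const_mul,
      integral_const_mul, integral_finsetSum _ hJ, integral_finsetSum _ fun i _ => hinvI i,
      integral_inner_pow_div e p he k hv hv',
      Finset.sum_congr rfl fun i _ => integral_div_inversion hN (a i) hv hv',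
      Finset.sum_neg_distrib]
    · ring
    · exact (integrable_finsetSum _ fun i _ => hinvI i).const_mul _
    · exact hlinI.const_mul _
    · exact (integrable_finsetSum _ hJ).const_mul _
    · simpa [mul_assoc] using hI1
  refine ⟨?_, integral_field_le hu hu' hFm hD hFI hdiv⟩
  simp_rw [sub_mul]
  exact hD.sub hFI

/-- The classical distortion formula for inversion in a sphere, applied to `x - a` and `x - b`. It
turns each term of the potential into a squared distance. -/
lemma norm_inversion_sub_sq {a b x : EuclideanSpace ℝ (Fin N)} (ha : x ≠ a) (hb : x ≠ b) :
    ‖inversion a x - inversion b x‖ ^ 2 = ‖a - b‖ ^ 2 / (‖x - a‖ ^ 2 * ‖x - b‖ ^ 2) := by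
  have h1 : ‖x - a‖ ≠ 0 := by simpa [sub_eq_zero] using ha
  have h2 : ‖x - b‖ ≠ 0 := by simpa [sub_eq_zero] using hb
  have h3 : ‖a - b‖ ^ 2 = ‖x - b‖ ^ 2 - 2 * inner ℝ (x - b) (x - a) + ‖x - a‖ ^ 2 := by
    rw [← norm_sub_sq_real]; congr 2; abel
  rw [norm_sub_sq_real, norm_inversion, norm_inversion, h3, inversion, inversion,
    real_inner_smul_left, real_inner_smul_right, real_inner_comm]
  field_simp

/-- Away from the poles, `V = n S - |Y|²` with `Y` the sum of the inversion fields and `S` the sum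
of their squared norms. -/
lemma potential_eq (a : Fin n → EuclideanSpace ℝ (Fin N)) {x : EuclideanSpace ℝ (Fin N)}
    (hx : ∀ i, x ≠ a i) :
    potential a x = n * ∑ i, (‖x - a i‖ ^ 2)⁻¹ - ‖∑ i, inversion (a i) x‖ ^ 2 := by
  have h1 : potential a x =
      ∑ i, ∑ j ∈ Finset.Ioi i, ‖inversion (a i) x - inversion (a j) x‖ ^ 2 := by
    unfold potential
    exact Finset.sum_congr rfl fun i _ => Finset.sum_congr rfl fun j _ =>
      (norm_inversion_sub_sq (hx i) (hx j)).symm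
  -- The sum over `i < j` is doubled into a sum over ordered pairs, to which the vanishing diagonal
  -- is added.
  have h2 := Finset.sum_sum_Ioi_add_eq_sum_sum_off_diag
    (fun i j => ‖inversion (a i) x - inversion (a j) x‖ ^ 2)
  have h3 : ∀ i, ∑ j ∈ ({i}ᶜ : Finset (Fin n)), ‖inversion (a j) x - inversion (a i) x‖ ^ 2 =
      ∑ j, ‖inversion (a j) x - inversion (a i) x‖ ^ 2 := by
    intro i
    refine Finset.sum_subset (Finset.subset_univ _) fun j _ hj => ?_
    have : j = i := by simpa using hj
    simp [this]
  have h4 : ∑ i, ∑ j, ‖inversion (a j) x - inversion (a i) x‖ ^ 2 = 2 * potential a x := by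
    rw [← Finset.sum_congr rfl fun i _ => h3 i, ← h2, h1, Finset.mul_sum]
    refine Finset.sum_congr rfl fun i _ => ?_
    rw [Finset.mul_sum]
    refine Finset.sum_congr rfl fun j _ => ?_
    rw [norm_sub_rev (inversion (a j) x)]; ring
  -- Lagrange's identity `∑ᵢⱼ |Xᵢ - Xⱼ|² = 2 n ∑ |Xᵢ|² - 2 |∑ Xᵢ|²`.
  have h5 : ∑ i, ∑ j, ‖inversion (a j) x - inversion (a i) x‖ ^ 2 =
      2 * (n * ∑ i, ‖inversion (a i) x‖ ^ 2 - ‖∑ i, inversion (a i) x‖ ^ 2) := by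
    simp_rw [norm_sub_sq_real, Finset.sum_add_distrib, Finset.sum_sub_distrib, ← Finset.mul_sum,
      ← sum_inner, ← inner_sum]
    simp [← Finset.mul_sum]
    ring
  simp_rw [norm_inversion, inv_pow] at h5
  linarith

lemma potential_nonneg (a : Fin n → EuclideanSpace ℝ (Fin N)) (x : EuclideanSpace ℝ (Fin N)) :
    0 ≤ potential a x :=
  Finset.sum_nonneg fun i _ => Finset.sum_nonneg fun j _ => by positivity

lemma measurable_potential (a : Fin n → EuclideanSpace ℝ (Fin N)) : Measurable (potential a) := by
  unfold potential; fun_prop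

lemma integrable_potential_mul (hN : 3 ≤ N) (a : Fin n → EuclideanSpace ℝ (Fin N))
    {g : EuclideanSpace ℝ (Fin N) → ℝ} (hg : Continuous g) (hg' : HasCompactSupport g) :
    Integrable (fun x => potential a x * g x) := by
  have hgm := hg.measurable
  refine ((integrable_sum_inv_norm_sq_mul hN a hg hg').norm.const_mul n).mono'
    ((measurable_potential a).mul hgm).aestronglyMeasurable ?_
  filter_upwards [ae_notMem_range hN a] with x hx
  rw [norm_mul, norm_mul, Real.norm_eq_abs, abs_of_nonneg (potential_nonneg a x), ← mul_assoc,
    Real.norm_eq_abs (∑ i, _), abs_of_nonneg (Finset.sum_nonneg fun i _ => by positivity)]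
  gcongr
  rw [potential_eq a hx]
  linarith [sq_nonneg ‖∑ i, inversion (a i) x‖]

end

end MultipolarHardy

/-! ### Hardy inequalities from particular fields -/

namespace MultipolarHardy

noncomputable section

variable {N n : ℕ}

lemma exists_norm_eq_one (hN : 3 ≤ N) : ∃ e : EuclideanSpace ℝ (Fin N), ‖e‖ = 1 :=
  ⟨EuclideanSpace.single ⟨0, by omega⟩ 1, by simp⟩

lemma integrable_potential_mul_sq (hN : 3 ≤ N) (a : Fin n → EuclideanSpace ℝ (Fin N))
    {u : EuclideanSpace ℝ (Fin N) → ℝ} (hu : Continuous u) (hu' : HasCompactSupport u) :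
    Integrable (fun x => potential a x * u x ^ 2) :=
  integrable_potential_mul hN a (hu.pow 2) (hasCompactSupport_sq hu')

lemma integrable_sq {u : EuclideanSpace ℝ (Fin N) → ℝ} (hu : Continuous u)
    (hu' : HasCompactSupport u) : Integrable (fun x => u x ^ 2) :=
  (hu.pow 2).integrable_of_hasCompactSupport (hasCompactSupport_sq hu')

/-- The inequality given by the field `α ∑ᵢ (x - aᵢ) / |x - aᵢ|²`. -/
lemma integral_sum_inversion_le (hN : 3 ≤ N) (a : Fin n → EuclideanSpace ℝ (Fin N)) (α : ℝ)
    {u : EuclideanSpace ℝ (Fin N) → ℝ} (hu : ContDiff ℝ 1 u) (hu' : HasCompactSupport u) :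
    Integrable (fun x => (α * (N - 2) * (∑ i, (‖x - a i‖ ^ 2)⁻¹) -
      α ^ 2 * ‖∑ i, inversion (a i) x‖ ^ 2) * u x ^ 2) ∧
    ∫ x, (α * (N - 2) * (∑ i, (‖x - a i‖ ^ 2)⁻¹) - α ^ 2 * ‖∑ i, inversion (a i) x‖ ^ 2) *
      u x ^ 2 ≤ ∫ x, ‖∇ u x‖ ^ 2 := by
  obtain ⟨e, he⟩ := exists_norm_eq_one hN
  -- `δ = 0` removes the perturbation, so `k`, `e` and the base point play no role.
  simpa [norm_smul, mul_pow] using integral_inversion_field_le hN a α 0 0 e 0 he hu hu'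

/-- The multipolar Hardy inequality on the whole space. -/
lemma multipolar_hardy (hN : 3 ≤ N) (hn : 2 ≤ n) (a : Fin n → EuclideanSpace ℝ (Fin N))
    {u : EuclideanSpace ℝ (Fin N) → ℝ} (hu : ContDiff ℝ 1 u) (hu' : HasCompactSupport u) :
    (((N : ℝ) - 2) / n) ^ 2 * ∫ x, potential a x * u x ^ 2 ≤ ∫ x, ‖∇ u x‖ ^ 2 := by
  -- For `α = (N - 2) / n`, `α (N - 2) S - α² |Y|² = α² (n S - |Y|²) = α² V`.
  refine le_of_eq_of_le ?_ (integral_sum_inversion_le hN a (((N : ℝ) - 2) / n) hu hu').2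
  rw [← integral_const_mul]
  refine integral_congr_ae ?_
  filter_upwards [ae_notMem_range hN a] with x hx
  have : (n : ℝ) ≠ 0 := by positivity
  rw [potential_eq a hx]
  field_simp

/-- If `d` is the least distance between two poles, every pole except the nearest one is at distance
at least `d / 2` from `x`. So `|Y|` exceeds the nearest pole's contribution by at most `2n / d`, and
Young's inequality splits the square. The leading constant 1, instead of `n`, is what gives the
right threshold. -/
lemma exists_norm_sum_inversion_sq_le (a : Fin n → EuclideanSpace ℝ (Fin N))
    (ha : Function.Injective a) {δ : ℝ} (hδ : 0 < δ) :
    ∃ C : ℝ, 0 ≤ C ∧ ∀ x, ‖∑ i, inversion (a i) x‖ ^ 2 ≤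
      (1 + δ) * ∑ i, (‖x - a i‖ ^ 2)⁻¹ + C := by
  classical
  obtain ⟨d, hd, hda⟩ : ∃ d : ℝ, 0 < d ∧ ∀ i j, i ≠ j → d ≤ ‖a i - a j‖ := by
    let s : Finset (Fin n × Fin n) := Finset.univ.filter fun q => q.1 ≠ q.2
    by_cases hs : s.Nonempty
    · obtain ⟨q, hq, hq'⟩ := s.exists_min_image (fun q => ‖a q.1 - a q.2‖) hs
      have hq1 : q.1 ≠ q.2 := by simpa [s] using hq
      refine ⟨‖a q.1 - a q.2‖, by simpa [sub_eq_zero] using ha.ne hq1, fun i j hij => ?_⟩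
      exact hq' (i, j) (by simpa [s] using hij)
    · refine ⟨1, one_pos, fun i j hij => ?_⟩
      exact (hs ⟨(i, j), by simpa [s] using hij⟩).elim
  refine ⟨(1 + δ⁻¹) * (n * (2 / d)) ^ 2, by positivity, fun x => ?_⟩
  rcases Nat.eq_zero_or_pos n with rfl | hn
  · simp
  obtain ⟨i, -, hi⟩ := Finset.exists_min_image Finset.univ (fun i => ‖x - a i‖)
    ⟨(⟨0, hn⟩ : Fin n), Finset.mem_univ _⟩
  have h1 : ∀ j, j ≠ i → ‖inversion (a j) x‖ ≤ 2 / d := by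
    intro j hj
    rw [norm_inversion]
    have h2 := hda j i hj
    have h3 : ‖a j - a i‖ ≤ ‖x - a j‖ + ‖x - a i‖ := by
      rw [← norm_neg (x - a j)]
      exact (norm_add_le _ _).trans' (by rw [show -(x - a j) + (x - a i) = a j - a i by abel])
    have h4 := hi j (Finset.mem_univ _)
    rw [← inv_div]
    gcongr
    linarith
  have h2 : ‖∑ j, inversion (a j) x‖ ≤ ‖inversion (a i) x‖ + n * (2 / d) := by
    rw [← Finset.add_sum_erase _ _ (Finset.mem_univ i)]
    refine (norm_add_le _ _).trans ?_
    gcongr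
    refine (norm_sum_le _ _).trans ?_
    refine (Finset.sum_le_card_nsmul _ _ (2 / d) fun j hj => h1 j (Finset.ne_of_mem_erase hj)).trans
      ?_
    rw [nsmul_eq_mul]
    gcongr
    exact (Finset.card_le_univ _).trans (by simp)
  have h3 : ‖inversion (a i) x‖ ^ 2 ≤ ∑ i, (‖x - a i‖ ^ 2)⁻¹ := by
    rw [norm_inversion, inv_pow]
    exact Finset.single_le_sum (f := fun i => (‖x - a i‖ ^ 2)⁻¹) (fun j _ => by positivity)
      (Finset.mem_univ i)
  set y := ‖inversion (a i) x‖
  set z := (n : ℝ) * (2 / d)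
  have h4 := pow_le_pow_left₀ (norm_nonneg _) h2 2
  have h5 : 2 * y * z ≤ δ * y ^ 2 + δ⁻¹ * z ^ 2 := by
    have : δ * y ^ 2 + δ⁻¹ * z ^ 2 - 2 * y * z = δ⁻¹ * (δ * y - z) ^ 2 := by field_simp; ring
    have h6 : 0 ≤ δ⁻¹ * (δ * y - z) ^ 2 := by positivity
    linarith
  nlinarith

/-- The weak Hardy inequality below the threshold. -/
lemma weak_hardy (hN : 3 ≤ N) (hn : 2 ≤ n) (a : Fin n → EuclideanSpace ℝ (Fin N))
    (ha : Function.Injective a) {μ : ℝ} (hμ : μ < ((N : ℝ) - 2) ^ 2 / (4 * n - 4)) :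
    ∃ c : ℝ, 0 ≤ c ∧ ∀ u : EuclideanSpace ℝ (Fin N) → ℝ, ContDiff ℝ 1 u → HasCompactSupport u →
      μ * ∫ x, potential a x * u x ^ 2 ≤ c * (∫ x, u x ^ 2) + ∫ x, ‖∇ u x‖ ^ 2 := by
  have hn' : (2 : ℝ) ≤ n := by exact_mod_cast hn
  -- This `α` maximises `α (N - 2) - α²`, the coefficient of `|x - aᵢ|⁻²` left near a pole.
  set α : ℝ := ((N : ℝ) - 2) / 2 with hα
  have hμ1 : μ * (n - 1) < α ^ 2 := by
    rw [lt_div_iff₀ (by linarith)] at hμ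
    rw [hα]; nlinarith
  have hμ2 : 0 < α ^ 2 - μ := by
    rcases le_or_gt μ 0 with h | h
    · have hN' : (3 : ℝ) ≤ N := by exact_mod_cast hN
      have : 0 < α := by rw [hα]; linarith
      have : 0 < α ^ 2 := by positivity
      linarith
    · nlinarith
  -- `δ` solves `(1 + δ) (α² - μ) = 2 α² - n μ`, which makes the `S` terms cancel; `δ > 0` is
  -- exactly the condition that `μ` is below the threshold.
  set δ : ℝ := (α ^ 2 - μ * (n - 1)) / (α ^ 2 - μ) with hδ
  have hδ0 : 0 < δ := div_pos (by linarith) hμ2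
  obtain ⟨C, hC, hY⟩ := exists_norm_sum_inversion_sq_le a ha hδ0
  refine ⟨(α ^ 2 - μ) * C, by positivity, fun u hu hu' => ?_⟩
  have hV := integrable_potential_mul_sq hN a hu.continuous hu'
  have hI := integrable_sq hu.continuous hu'
  obtain ⟨h1, h2⟩ := integral_sum_inversion_le hN a α hu hu'
  have h3 : ∫ x, (μ * (potential a x * u x ^ 2) - (α ^ 2 - μ) * C * u x ^ 2) ≤
      ∫ x, (α * (N - 2) * (∑ i, (‖x - a i‖ ^ 2)⁻¹) - α ^ 2 * ‖∑ i, inversion (a i) x‖ ^ 2) *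
        u x ^ 2 := by
    refine integral_mono_ae ((hV.const_mul μ).sub (hI.const_mul _)) h1 ?_
    filter_upwards [ae_notMem_range hN a] with x hx
    rw [potential_eq a hx]
    have h4 := mul_le_mul_of_nonneg_left (hY x) hμ2.le
    set S := ∑ i, (‖x - a i‖ ^ 2)⁻¹
    set Y := ‖∑ i, inversion (a i) x‖ ^ 2
    have h5 : (α ^ 2 - μ) * ((1 + δ) * S + C) = (2 * α ^ 2 - n * μ) * S + (α ^ 2 - μ) * C := by
      rw [hδ]; field_simp; ring
    have h6 : α * (N - 2) = 2 * α ^ 2 := by rw [hα]; ring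
    rw [h6, ← mul_assoc, ← sub_mul]
    refine mul_le_mul_of_nonneg_right ?_ (sq_nonneg _)
    linarith
  rw [integral_sub (hV.const_mul μ) (hI.const_mul _), integral_const_mul, integral_const_mul] at h3
  linarith

lemma le_potential (a : Fin n → EuclideanSpace ℝ (Fin N)) (x : EuclideanSpace ℝ (Fin N))
    {i j : Fin n} (hij : i < j) :
    ‖a i - a j‖ ^ 2 / (‖x - a i‖ ^ 2 * ‖x - a j‖ ^ 2) ≤ potential a x := by
  unfold potential
  refine le_trans ?_ (Finset.single_le_sum (fun k _ => Finset.sum_nonneg fun l _ => ?_)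
    (Finset.mem_univ i))
  · exact Finset.single_le_sum (f := fun j => ‖a i - a j‖ ^ 2 / (‖x - a i‖ ^ 2 * ‖x - a j‖ ^ 2))
      (fun l _ => by positivity) (Finset.mem_Ioi.2 hij)
  · positivity

lemma potential_pos (hn : 2 ≤ n) (a : Fin n → EuclideanSpace ℝ (Fin N))
    (ha : Function.Injective a) {x : EuclideanSpace ℝ (Fin N)} (hx : ∀ i, x ≠ a i) :
    0 < potential a x := by
  set i : Fin n := ⟨0, by omega⟩
  set j : Fin n := ⟨1, by omega⟩
  have hij : i < j := by simp [i, j, Fin.lt_def]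
  refine lt_of_lt_of_le ?_ (le_potential a x hij)
  have h1 := sub_ne_zero.2 (ha.ne hij.ne)
  have h2 := sub_ne_zero.2 (hx i)
  have h3 := sub_ne_zero.2 (hx j)
  positivity

/-- The Poincaré inequality, in a bounded set. -/
lemma exists_integral_sq_le (hN : 3 ≤ N) (hn : 2 ≤ n) (a : Fin n → EuclideanSpace ℝ (Fin N))
    (ha : Function.Injective a) {s : Set (EuclideanSpace ℝ (Fin N))} (hs : Bornology.IsBounded s) :
    ∃ C : ℝ, 0 ≤ C ∧ ∀ u : EuclideanSpace ℝ (Fin N) → ℝ, ContDiff ℝ 1 u → HasCompactSupport u →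
      Function.support u ⊆ s → ∫ x, u x ^ 2 ≤ C * ∫ x, ‖∇ u x‖ ^ 2 := by
  obtain ⟨R, hR, hsR⟩ := hs.exists_pos_norm_le
  set i : Fin n := ⟨0, by omega⟩
  set j : Fin n := ⟨1, by omega⟩
  have hij : a i ≠ a j := ha.ne (by simp [i, j])
  have hd : 0 < ‖a i - a j‖ ^ 2 := by have := sub_ne_zero.2 hij; positivity
  -- On `s` a single term of `V` is already at least `|aᵢ - aⱼ|² / M`, so the `L²` norm is
  -- controlled by `∫ V u²` and then by `multipolar_hardy`.
  set M : ℝ := (R + ‖a i‖) ^ 2 * (R + ‖a j‖) ^ 2 with hM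
  have hM0 : 0 < M := by positivity
  have hNn : 0 < (((N : ℝ) - 2) / n) ^ 2 := by
    have hN' : (3 : ℝ) ≤ N := by exact_mod_cast hN
    have hn' : (2 : ℝ) ≤ n := by exact_mod_cast hn
    have : 0 < ((N : ℝ) - 2) / n := div_pos (by linarith) (by linarith)
    positivity
  refine ⟨M / ‖a i - a j‖ ^ 2 * ((((N : ℝ) - 2) / n) ^ 2)⁻¹, by positivity,
    fun u hu hu' hus => ?_⟩
  have hV := integrable_potential_mul_sq hN a hu.continuous hu'
  have hI := integrable_sq hu.continuous hu'
  have h1 : ∫ x, u x ^ 2 ≤ M / ‖a i - a j‖ ^ 2 * ∫ x, potential a x * u x ^ 2 := by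
    rw [← integral_const_mul]
    refine integral_mono_ae hI (hV.const_mul _) ?_
    filter_upwards [ae_notMem_range hN a] with x hx
    rcases eq_or_ne (u x) 0 with h0 | h0
    · simp [h0]
    have hxR := hsR x (hus h0)
    have hxi : 0 < ‖x - a i‖ := by have := sub_ne_zero.2 (hx i); positivity
    have hxj : 0 < ‖x - a j‖ := by have := sub_ne_zero.2 (hx j); positivity
    have h2 := le_potential a x (by simp [i, j, Fin.lt_def] : i < j)
    have h3 : ‖x - a i‖ ^ 2 * ‖x - a j‖ ^ 2 ≤ M := by
      have h4 := norm_sub_le x (a i)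
      have h5 := norm_sub_le x (a j)
      rw [hM]; gcongr <;> linarith
    have h6 : 1 ≤ M / ‖a i - a j‖ ^ 2 * potential a x := by
      calc 1 = M / ‖a i - a j‖ ^ 2 * (‖a i - a j‖ ^ 2 / M) := by
            rw [div_mul_div_cancel₀ hd.ne', div_self hM0.ne']
        _ ≤ M / ‖a i - a j‖ ^ 2 * (‖a i - a j‖ ^ 2 / (‖x - a i‖ ^ 2 * ‖x - a j‖ ^ 2)) := by
            gcongr
        _ ≤ _ := by gcongr
    calc u x ^ 2 = 1 * u x ^ 2 := by ring
      _ ≤ M / ‖a i - a j‖ ^ 2 * potential a x * u x ^ 2 := by gcongr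
      _ = _ := by ring
  refine h1.trans ?_
  rw [mul_assoc]
  gcongr
  rw [inv_mul_eq_div, le_div_iff₀ hNn, mul_comm]
  exact multipolar_hardy hN hn a hu hu'

/-- For two poles the Hardy inequality on a bounded set has a remainder term. -/
lemma exists_two_pole_hardy_remainder (hN : 3 ≤ N) (a : Fin 2 → EuclideanSpace ℝ (Fin N))
    {s : Set (EuclideanSpace ℝ (Fin N))} (hs : Bornology.IsBounded s) :
    ∃ (δ : ℝ) (e : EuclideanSpace ℝ (Fin N)), 0 < δ ∧ ‖e‖ = 1 ∧
      ∀ u : EuclideanSpace ℝ (Fin N) → ℝ, ContDiff ℝ 1 u → HasCompactSupport u →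
      Function.support u ⊆ s → (((N : ℝ) - 2) / 2) ^ 2 * (∫ x, potential a x * u x ^ 2) +
        δ * (∫ x, inner ℝ e (x - a 0) ^ (2 * N) * u x ^ 2) ≤ ∫ x, ‖∇ u x‖ ^ 2 := by
  obtain ⟨R, hR, hsR⟩ := hs.exists_pos_norm_le
  -- Orthogonality to the line of the poles gives `⟨e, x - a₀⟩ = ⟨e, x - a₁⟩ = t`, hence `⟨Y, e⟩ = t
  -- S`.
  obtain ⟨e, he, hea⟩ : ∃ e : EuclideanSpace ℝ (Fin N), ‖e‖ = 1 ∧ inner ℝ e (a 0 - a 1) = 0 := by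
    obtain ⟨w, hw, hw0⟩ : ∃ w ∈ (ℝ ∙ (a 0 - a 1))ᗮ, w ≠ 0 := by
      refine Submodule.exists_mem_ne_zero_of_ne_bot fun h => ?_
      rw [Submodule.orthogonal_eq_bot_iff] at h
      have h1 : Module.finrank ℝ (ℝ ∙ (a 0 - a 1)) ≤ 1 := (finrank_span_le_card _).trans (by simp)
      rw [h, finrank_top, finrank_euclideanSpace_fin] at h1
      omega
    refine ⟨‖w‖⁻¹ • w, norm_smul_inv_norm hw0, ?_⟩
    rw [real_inner_smul_left, real_inner_comm, Submodule.mem_orthogonal_singleton_iff_inner_right.1 hw,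
      mul_zero]
  set α : ℝ := ((N : ℝ) - 2) / 2 with hα
  have hα0 : 0 < α := by
    have hN' : (3 : ℝ) ≤ N := by exact_mod_cast hN
    rw [hα]; linarith
  set T : ℝ := R + ‖a 0‖ with hT
  -- Since `|t| ≤ T` on `s`, this makes `δ t^(2N+2) ≤ 1`.
  set δ : ℝ := (T ^ (2 * N + 2))⁻¹ with hδ
  have hT0 : 0 < T := by positivity
  have hδ0 : 0 < δ := by positivity
  refine ⟨δ, e, hδ0, he, fun u hu hu' hus => ?_⟩
  have hV := integrable_potential_mul_sq hN a hu.continuous hu'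
  have hI : Integrable (fun x => inner ℝ e (x - a 0) ^ (2 * N) * u x ^ 2) := by
    have := hu.continuous
    exact Continuous.integrable_of_hasCompactSupport (by fun_prop)
      (hasCompactSupport_sq hu').mul_left
  obtain ⟨h1, h2⟩ := integral_inversion_field_le hN a α δ (2 * N) e (a 0) he hu hu'
  refine le_trans ?_ h2
  rw [← integral_const_mul, ← integral_const_mul, ← integral_add (hV.const_mul _) (hI.const_mul _)]
  refine integral_mono_ae ((hV.const_mul _).add (hI.const_mul _)) h1 ?_
  filter_upwards [ae_notMem_range hN a] with x hx
  rcases eq_or_ne (u x) 0 with h0 | h0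
  · simp [h0]
  set t : ℝ := inner ℝ e (x - a 0) with ht
  have ht1 : inner ℝ e (x - a 1) = t := by
    rw [show x - a 1 = (x - a 0) + (a 0 - a 1) by abel, inner_add_right, hea, add_zero]
  have htT : t ^ (2 * N + 2) ≤ T ^ (2 * N + 2) := by
    have h3 : |t| ≤ T := by
      refine (abs_real_inner_le_norm _ _).trans ?_
      rw [he, one_mul]
      exact (norm_sub_le _ _).trans (by rw [hT]; gcongr; exact hsR x (hus h0))
    calc t ^ (2 * N + 2) = |t| ^ (2 * N + 2) := by
          rw [show 2 * N + 2 = 2 * (N + 1) by ring, pow_mul, pow_mul, sq_abs]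
      _ ≤ _ := by gcongr
  have hδt : δ * t ^ (2 * N + 2) ≤ 1 := by
    rw [hδ, inv_mul_le_iff₀ (by positivity), mul_one]; exact htT
  have htk : 0 ≤ t ^ (2 * N) := by rw [pow_mul]; positivity
  have hti : ∀ i, t ^ 2 * (‖x - a i‖ ^ 2)⁻¹ ≤ 1 := by
    intro i
    have hxi : 0 < ‖x - a i‖ := by have := sub_ne_zero.2 (hx i); positivity
    have h3 : inner ℝ e (x - a i) = t := by
      fin_cases i
      · rfl
      · exact ht1
    have h4 := abs_real_inner_le_norm e (x - a i)
    rw [h3, he, one_mul] at h4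
    rw [← div_eq_mul_inv, div_le_one (by positivity), ← sq_abs t]
    gcongr
  have hYe : inner ℝ (∑ i, inversion (a i) x) e = t * ∑ i, (‖x - a i‖ ^ 2)⁻¹ := by
    simp only [Fin.sum_univ_two, inversion, inner_add_left, real_inner_smul_left]
    rw [real_inner_comm, ← ht, real_inner_comm, ht1]; ring
  have hsum : t ^ 2 * ∑ i, (‖x - a i‖ ^ 2)⁻¹ ≤ 2 := by
    rw [Fin.sum_univ_two, mul_add]; linarith [hti 0, hti 1]
  rw [potential_eq a hx, norm_add_sq_real, inner_smul_left, inner_smul_right, hYe, norm_smul,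
    norm_smul, he, mul_one, mul_pow, Real.norm_eq_abs, Real.norm_eq_abs, sq_abs, sq_abs]
  set S := ∑ i, (‖x - a i‖ ^ 2)⁻¹
  set Y := ‖∑ i, inversion (a i) x‖ ^ 2
  have h6 : (N : ℝ) - 2 = 2 * α := by rw [hα]; ring
  have h7 : (N : ℝ) = 2 * α + 2 := by rw [hα]; ring
  simp only [← mul_assoc]
  rw [← add_mul]
  refine mul_le_mul_of_nonneg_right ?_ (sq_nonneg _)
  push_cast
  simp only [conj_trivial]
  have e1 : t ^ (2 * N + 1) = t ^ (2 * N) * t := pow_succ _ _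
  have e2 : t ^ (2 * N + 2) = t ^ (2 * N) * t ^ 2 := pow_add _ _ _
  rw [e2] at hδt
  set q := t ^ (2 * N)
  rw [e1, h6]
  -- The perturbation adds `(2N + 1) δ q` to the divergence. The cross term costs at most `2 (N - 2)
  -- δ q`, because `t² S ≤ 2`, and its own square at most `δ q`. What remains is `4 δ q`, more than
  -- the `δ q` claimed.
  have h8 : δ * q * (δ * (q * t ^ 2)) ≤ δ * q * 1 := by gcongr
  have h9 : 2 * α * δ * q * (t ^ 2 * S) ≤ 2 * α * δ * q * 2 := by gcongr
  rw [h7]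
  nlinarith [mul_nonneg hδ0.le htk]

end

end MultipolarHardy

/-! ### Rellich's theorem by averaging over cubes -/

namespace MultipolarHardy

noncomputable section

variable {N : ℕ}

/-- Nonnegativity of the variance of `f` on the unit interval. -/
lemma sq_intervalIntegral_le {f : ℝ → ℝ} (hf : Continuous f) :
    (∫ t in (0 : ℝ)..1, f t) ^ 2 ≤ ∫ t in (0 : ℝ)..1, f t ^ 2 := by
  set c := ∫ t in (0 : ℝ)..1, f t with hc
  have h0 : 0 ≤ ∫ t in (0 : ℝ)..1, (f t - c) ^ 2 :=
    intervalIntegral.integral_nonneg zero_le_one fun t _ => sq_nonneg _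
  have h1 : ∀ t, (f t - c) ^ 2 = f t ^ 2 - 2 * c * f t + c ^ 2 := fun t => by ring
  simp_rw [h1] at h0
  rw [intervalIntegral.integral_add, intervalIntegral.integral_sub,
    intervalIntegral.integral_const_mul, ← hc] at h0
  · simp at h0; nlinarith
  all_goals exact Continuous.intervalIntegrable (by fun_prop) _ _

/-- The difference is the integral of the derivative along the segment from `x` to `x + h`;
Cauchy–Schwarz in `t`, Tonelli and translation invariance give the bound. -/
lemma lintegral_translate_sub_sq_le {w : EuclideanSpace ℝ (Fin N) → ℝ} (hw : ContDiff ℝ 1 w)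
    (h : EuclideanSpace ℝ (Fin N)) :
    ∫⁻ x, ENNReal.ofReal ((w x - w (x + h)) ^ 2) ≤
      ENNReal.ofReal (‖h‖ ^ 2) * ∫⁻ x, ENNReal.ofReal (‖∇ w x‖ ^ 2) := by
  have hg := continuous_gradient hw
  have hd : Continuous (fderiv ℝ w) := hw.continuous_fderiv (by simp)
  have key : ∀ x, (w x - w (x + h)) ^ 2 ≤
      ‖h‖ ^ 2 * ∫ t in (0 : ℝ)..1, ‖∇ w (x + t • h)‖ ^ 2 := by
    intro x
    have h1 : ∫ t in (0 : ℝ)..1, fderiv ℝ w (x + t • h) h = w (x + h) - w x := by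
      have := intervalIntegral.integral_eq_sub_of_hasDerivAt (a := 0) (b := 1)
        (f := fun t : ℝ => w (x + t • h)) (f' := fun t => fderiv ℝ w (x + t • h) h) ?_ ?_
      · simpa using this
      · intro t _
        have h2 : HasDerivAt (fun t : ℝ => x + t • h) h t := by
          simpa using ((hasDerivAt_id t).smul_const h).const_add x
        exact ((hw.differentiable (by simp)) (x + t • h)).hasFDerivAt.comp_hasDerivAt t h2
      · exact Continuous.intervalIntegrable (by fun_prop) _ _
    rw [← neg_sub, neg_sq, ← h1, ← intervalIntegral.integral_const_mul]
    refine (sq_intervalIntegral_le (by fun_prop)).trans ?_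
    refine intervalIntegral.integral_mono zero_le_one
      (Continuous.intervalIntegrable (by fun_prop) _ _)
      (Continuous.intervalIntegrable (by fun_prop) _ _) fun t => ?_
    simp only
    rw [← inner_gradient_left, ← mul_pow, ← sq_abs, mul_comm]
    gcongr
    exact abs_real_inner_le_norm _ _
  calc ∫⁻ x, ENNReal.ofReal ((w x - w (x + h)) ^ 2)
      ≤ ∫⁻ x, ENNReal.ofReal (‖h‖ ^ 2) *
          ∫⁻ t in Set.Ioc (0 : ℝ) 1, ENNReal.ofReal (‖∇ w (x + t • h)‖ ^ 2) := by
        refine lintegral_mono fun x => ?_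
        rw [← ofReal_integral_eq_lintegral_ofReal, ← ENNReal.ofReal_mul (by positivity),
          ← intervalIntegral.integral_of_le zero_le_one]
        · exact ENNReal.ofReal_le_ofReal (key x)
        · have : Continuous fun t : ℝ => ‖∇ w (x + t • h)‖ ^ 2 := by fun_prop
          exact (this.intervalIntegrable 0 1).1
        · exact Eventually.of_forall fun t => by positivity
    _ = ENNReal.ofReal (‖h‖ ^ 2) *
          ∫⁻ t in Set.Ioc (0 : ℝ) 1, ∫⁻ x, ENNReal.ofReal (‖∇ w (x + t • h)‖ ^ 2) := by
        rw [lintegral_const_mul' _ _ ENNReal.ofReal_ne_top, lintegral_lintegral_swap]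
        have : Continuous fun q : EuclideanSpace ℝ (Fin N) × ℝ =>
          ENNReal.ofReal (‖∇ w (q.1 + q.2 • h)‖ ^ 2) :=
          ENNReal.continuous_ofReal.comp (by fun_prop)
        exact this.measurable.aemeasurable
    _ = _ := by
        congr 1
        have : ∀ t : ℝ, ∫⁻ x, ENNReal.ofReal (‖∇ w (x + t • h)‖ ^ 2) =
            ∫⁻ x, ENNReal.ofReal (‖∇ w x‖ ^ 2) := fun t =>
          lintegral_add_right_eq_self (fun x => ENNReal.ofReal (‖∇ w x‖ ^ 2)) (t • h)
        simp_rw [this]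
        simp

/-- The half-open cube of side `1 / m` with index `z`. -/
def cube (m : ℕ) (z : Fin N → ℤ) : Set (EuclideanSpace ℝ (Fin N)) :=
  {x | BoxIntegral.unitPartition.index m x.ofLp = z}

lemma measurableSet_cube (m : ℕ) [NeZero m] (z : Fin N → ℤ) :
    MeasurableSet (cube m z : Set (EuclideanSpace ℝ (Fin N))) := by
  have : (cube m z : Set (EuclideanSpace ℝ (Fin N))) =
      (WithLp.ofLp : EuclideanSpace ℝ (Fin N) → Fin N → ℝ) ⁻¹'
        (BoxIntegral.unitPartition.box m z : Set (Fin N → ℝ)) := by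
    ext x; exact BoxIntegral.unitPartition.mem_box_iff_index.symm
  rw [this]
  exact (PiLp.volume_preserving_ofLp (Fin N)).measurable
    (BoxIntegral.Box.measurableSet_coe _)

lemma volume_cube (m : ℕ) [NeZero m] (z : Fin N → ℤ) :
    volume (cube m z : Set (EuclideanSpace ℝ (Fin N))) = ENNReal.ofReal (1 / m ^ N) := by
  have : (cube m z : Set (EuclideanSpace ℝ (Fin N))) =
      (WithLp.ofLp : EuclideanSpace ℝ (Fin N) → Fin N → ℝ) ⁻¹'
        (BoxIntegral.unitPartition.box m z : Set (Fin N → ℝ)) := by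
    ext x; exact BoxIntegral.unitPartition.mem_box_iff_index.symm
  have hm : (0 : ℝ) < m := by exact_mod_cast Nat.pos_of_neZero m
  rw [this, (PiLp.volume_preserving_ofLp (Fin N)).measure_preimage
    (BoxIntegral.Box.measurableSet_coe _).nullMeasurableSet,
    BoxIntegral.unitPartition.volume_box, ENNReal.ofReal_div_of_pos (by positivity),
    ENNReal.ofReal_pow hm.le]
  simp

lemma abs_sub_le_of_mem_cube {m : ℕ} [NeZero m] {z : Fin N → ℤ} {x y : EuclideanSpace ℝ (Fin N)}
    (hx : x ∈ cube m z) (hy : y ∈ cube m z) (i : Fin N) : |y i - x i| ≤ 1 / m := by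
  have h1 := BoxIntegral.unitPartition.mem_box_iff.1
    (BoxIntegral.unitPartition.mem_box_iff_index.2 hx) i
  have h2 := BoxIntegral.unitPartition.mem_box_iff.1
    (BoxIntegral.unitPartition.mem_box_iff_index.2 hy) i
  have h3 : ((z i : ℝ) + 1) / m = z i / m + 1 / m := add_div _ _ _
  rw [abs_le]
  constructor <;> linarith [h1.1, h1.2, h2.1, h2.2]

/-- The double integral measures the deviation of `w` from its mean on `s`; in this form it can be
bounded by translates. -/
lemma two_mul_setIntegral_sq_sub {s : Set (EuclideanSpace ℝ (Fin N))} (hs : volume s ≠ ∞)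
    {w : EuclideanSpace ℝ (Fin N) → ℝ} (hw : Continuous w) (hw' : HasCompactSupport w) :
    ENNReal.ofReal (2 * volume.real s * (∫ x in s, w x ^ 2) - 2 * (∫ x in s, w x) ^ 2) =
      ∫⁻ x in s, ∫⁻ y in s, ENNReal.ofReal ((w x - w y) ^ 2) := by
  have : IsFiniteMeasure (volume.restrict s) := ⟨by simpa using hs.lt_top⟩
  have i1 : IntegrableOn w s := (hw.integrable_of_hasCompactSupport hw').integrableOn
  have i2 : IntegrableOn (fun x => w x ^ 2) s := (integrable_sq hw hw').integrableOn
  set A := ∫ x in s, w x with hA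
  set B := ∫ x in s, w x ^ 2 with hB
  have e : ∀ x y, (w x - w y) ^ 2 = w x ^ 2 - 2 * w x * w y + w y ^ 2 := fun x y => by ring
  have j1 : ∀ x, IntegrableOn (fun y => w x ^ 2 - 2 * w x * w y) s := fun x =>
    (integrable_const _).sub (i1.const_mul _)
  have inner : ∀ x, ∫⁻ y in s, ENNReal.ofReal ((w x - w y) ^ 2) =
      ENNReal.ofReal (volume.real s * w x ^ 2 - 2 * A * w x + B) := by
    intro x
    rw [← ofReal_integral_eq_lintegral_ofReal]
    · congr 1
      simp_rw [e]
      rw [integral_add (j1 x) i2, integral_sub (integrable_const _) (i1.const_mul _),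
        integral_const_mul, ← hA, ← hB]
      simp
      ring
    · simp_rw [e]
      exact (j1 x).add i2
    · exact Eventually.of_forall fun t => sq_nonneg _
  have j2 : IntegrableOn (fun x => volume.real s * w x ^ 2 - 2 * A * w x) s :=
    (i2.const_mul _).sub (i1.const_mul _)
  simp_rw [inner]
  rw [← ofReal_integral_eq_lintegral_ofReal]
  · congr 1
    rw [integral_add j2 (integrable_const _), integral_sub (i2.const_mul _) (i1.const_mul _),
      integral_const_mul, integral_const_mul, ← hA, ← hB]
    simp
    ring
  · exact j2.add (integrable_const _)
  · refine Eventually.of_forall fun x => ?_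
    have h0 : 0 ≤ ∫ y in s, (w x - w y) ^ 2 := integral_nonneg fun y => sq_nonneg _
    simp_rw [e] at h0
    rw [integral_add (j1 x) i2, integral_sub (integrable_const _) (i1.const_mul _),
        integral_const_mul, ← hA, ← hB] at h0
    simp at h0
    simp only [Pi.zero_apply]
    linarith

/-- Two points of one cube differ by a vector `h` with coordinates at most `1 / m` in absolute
value. After substituting `y = x + h` the disjoint cubes merge into the whole space, and the
translation estimate applies for each `h`, with `|h|² ≤ N / m²`. -/
lemma sum_cube_lintegral_le (m : ℕ) [NeZero m] (Z : Finset (Fin N → ℤ))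
    {w : EuclideanSpace ℝ (Fin N) → ℝ} (hw : ContDiff ℝ 1 w) :
    ∑ z ∈ Z, ∫⁻ x in cube m z, ∫⁻ y in cube m z, ENNReal.ofReal ((w x - w y) ^ 2) ≤
      ENNReal.ofReal ((2 / m) ^ N * (N / m ^ 2)) * ∫⁻ x, ENNReal.ofReal (‖∇ w x‖ ^ 2) := by
  have hm : (0 : ℝ) < m := by exact_mod_cast Nat.pos_of_neZero m
  have hwc := hw.continuous
  set H : Set (EuclideanSpace ℝ (Fin N)) := (WithLp.ofLp : EuclideanSpace ℝ (Fin N) → Fin N → ℝ) ⁻¹'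
    (Set.univ.pi fun _ => Set.Icc (-(1 / m : ℝ)) (1 / m)) with hH
  have hHm : MeasurableSet H := (PiLp.volume_preserving_ofLp (Fin N)).measurable
    (MeasurableSet.univ_pi fun _ => measurableSet_Icc)
  have hHv : volume H = ENNReal.ofReal ((2 / m) ^ N) := by
    rw [hH, (PiLp.volume_preserving_ofLp (Fin N)).measure_preimage
      (MeasurableSet.univ_pi fun _ => measurableSet_Icc).nullMeasurableSet, volume_pi,
      Measure.pi_pi]
    simp only [Real.volume_Icc, Finset.prod_const, Finset.card_univ, Fintype.card_fin]
    rw [show (1 / m - -(1 / m) : ℝ) = 2 / m by ring, ← ENNReal.ofReal_pow (by positivity)]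
  have hHn : ∀ h ∈ H, ‖h‖ ^ 2 ≤ N / m ^ 2 := by
    intro h hh
    rw [EuclideanSpace.norm_sq_eq]
    have : ∀ i ∈ Finset.univ, ‖h i‖ ^ 2 ≤ 1 / (m : ℝ) ^ 2 := by
      intro i _
      have h1 := hh i (Set.mem_univ i)
      rw [Real.norm_eq_abs]
      calc |h i| ^ 2 ≤ (1 / m) ^ 2 := by gcongr; exact abs_le.2 h1
        _ = _ := by rw [div_pow, one_pow]
    refine (Finset.sum_le_card_nsmul _ _ _ this).trans (le_of_eq ?_)
    simp [div_eq_mul_inv]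
  have hmeas : Measurable fun q : EuclideanSpace ℝ (Fin N) × EuclideanSpace ℝ (Fin N) =>
      ENNReal.ofReal ((w q.1 - w (q.1 + q.2)) ^ 2) :=
    (ENNReal.continuous_ofReal.comp (by fun_prop)).measurable
  calc ∑ z ∈ Z, ∫⁻ x in cube m z, ∫⁻ y in cube m z, ENNReal.ofReal ((w x - w y) ^ 2)
      ≤ ∑ z ∈ Z, ∫⁻ x in cube m z, ∫⁻ h in H, ENNReal.ofReal ((w x - w (x + h)) ^ 2) := by
        refine Finset.sum_le_sum fun z _ => setLIntegral_mono' (measurableSet_cube m z)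
          fun x hx => ?_
        rw [← lintegral_indicator (measurableSet_cube m z), ← lintegral_indicator hHm,
          ← lintegral_add_left_eq_self _ x]
        refine lintegral_mono fun h => ?_
        by_cases hh : x + h ∈ cube m z
        · have : h ∈ H := fun i _ => by
            have := abs_sub_le_of_mem_cube hx hh i
            simpa [abs_le] using this
          simp [this, hh]
        · simp [hh]
    _ = ∫⁻ x in ⋃ z ∈ Z, cube m z, ∫⁻ h in H, ENNReal.ofReal ((w x - w (x + h)) ^ 2) := by
        rw [lintegral_biUnion_finset _ fun z _ => measurableSet_cube m z]
        intro z _ z' _ hzz'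
        refine Set.disjoint_left.2 fun x hx hx' => hzz' ?_
        exact hx.symm.trans hx'
    _ ≤ ∫⁻ x, ∫⁻ h in H, ENNReal.ofReal ((w x - w (x + h)) ^ 2) := setLIntegral_le_lintegral _ _
    _ = ∫⁻ h in H, ∫⁻ x, ENNReal.ofReal ((w x - w (x + h)) ^ 2) :=
        lintegral_lintegral_swap hmeas.aemeasurable
    _ ≤ ∫⁻ h in H, ENNReal.ofReal (N / m ^ 2) * ∫⁻ x, ENNReal.ofReal (‖∇ w x‖ ^ 2) := by
        refine setLIntegral_mono' hHm fun h hh => (lintegral_translate_sub_sq_le hw h).trans ?_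
        gcongr
        exact hHn h hh
    _ = _ := by
        rw [setLIntegral_const, hHv, ENNReal.ofReal_mul (by positivity)]
        ring

/-- The Poincaré inequality on a grid of cubes of side `1 / m`. -/
lemma integral_sq_le_sum_cube (m : ℕ) [NeZero m] (Z : Finset (Fin N → ℤ))
    {w : EuclideanSpace ℝ (Fin N) → ℝ} (hw : ContDiff ℝ 1 w) (hw' : HasCompactSupport w)
    (hZ : ∀ x, w x ≠ 0 → BoxIntegral.unitPartition.index m x.ofLp ∈ Z) :
    ∫ x, w x ^ 2 ≤ m ^ N * ∑ z ∈ Z, (∫ x in cube m z, w x) ^ 2 +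
      2 ^ N * N / m ^ 2 * ∫ x, ‖∇ w x‖ ^ 2 := by
  have hm : (0 : ℝ) < m := by exact_mod_cast Nat.pos_of_neZero m
  have hdisj : Set.Pairwise (Z : Set (Fin N → ℤ))
      (Function.onFun Disjoint (cube m : _ → Set (EuclideanSpace ℝ (Fin N)))) := by
    intro z _ z' _ hzz'
    exact Set.disjoint_left.2 fun x hx hx' => hzz' (hx.symm.trans hx')
  have h1 : ∫ x, w x ^ 2 = ∑ z ∈ Z, ∫ x in cube m z, w x ^ 2 := by
    rw [← integral_biUnion_finset Z (fun z _ => measurableSet_cube m z) hdisj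
      (fun z _ => (integrable_sq hw.continuous hw').integrableOn),
      setIntegral_eq_integral_of_forall_compl_eq_zero]
    intro x hx
    by_contra h
    refine hx (Set.mem_biUnion (hZ x fun h0 => h (by simp [h0])) ?_)
    rfl
  have hvol : ∀ z, volume.real (cube m z : Set (EuclideanSpace ℝ (Fin N))) = 1 / m ^ N := fun z => by
    rw [measureReal_def, volume_cube, ENNReal.toReal_ofReal (by positivity)]
  have h2 := sum_cube_lintegral_le m Z hw
  have h3 : ∀ z ∈ Z, ∫⁻ x in cube m z, ∫⁻ y in cube m z, ENNReal.ofReal ((w x - w y) ^ 2) =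
      ENNReal.ofReal (2 * (1 / m ^ N) * (∫ x in cube m z, w x ^ 2) -
        2 * (∫ x in cube m z, w x) ^ 2) := by
    intro z _
    rw [← two_mul_setIntegral_sq_sub (by rw [volume_cube]; exact ENNReal.ofReal_ne_top)
      hw.continuous hw', hvol]
  rw [Finset.sum_congr rfl h3, ← ofReal_integral_eq_lintegral_ofReal
    (integrable_norm_gradient_sq hw hw') (Eventually.of_forall fun x => by positivity),
    ← ENNReal.ofReal_mul (by positivity)] at h2
  have h4 : ∑ z ∈ Z, (2 * (1 / m ^ N) * (∫ x in cube m z, w x ^ 2) -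
        2 * (∫ x in cube m z, w x) ^ 2) ≤ (2 / m) ^ N * (N / m ^ 2) * ∫ x, ‖∇ w x‖ ^ 2 := by
    have h5 := (Finset.le_sum_of_subadditive ENNReal.ofReal ENNReal.ofReal_zero.le
      (fun x y => ENNReal.ofReal_add_le) Z fun z => 2 * (1 / (m : ℝ) ^ N) *
        (∫ x in cube m z, w x ^ 2) - 2 * (∫ x in cube m z, w x) ^ 2).trans h2
    rwa [ENNReal.ofReal_le_ofReal_iff] at h5
    have : 0 ≤ ∫ x, ‖∇ w x‖ ^ 2 := integral_nonneg fun x => by positivity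
    positivity
  rw [Finset.sum_sub_distrib, ← Finset.mul_sum, ← Finset.mul_sum, ← h1] at h4
  -- The argument yields half of the stated gradient term; nonnegativity allows the factor to be
  -- dropped.
  have h6 : 0 ≤ 2 ^ N * N / m ^ 2 * ∫ x, ‖∇ w x‖ ^ 2 := by
    have : 0 ≤ ∫ x, ‖∇ w x‖ ^ 2 := integral_nonneg fun x => by positivity
    positivity
  have h7 := mul_le_mul_of_nonneg_left h4 (by positivity : 0 ≤ (m : ℝ) ^ N / 2)
  have h8 : (m : ℝ) ^ N / 2 * ((2 / m) ^ N * (N / m ^ 2) * ∫ x, ‖∇ w x‖ ^ 2) =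
      (2 ^ N * N / m ^ 2 * ∫ x, ‖∇ w x‖ ^ 2) / 2 := by
    rw [div_pow]; field_simp
  have h9 : (m : ℝ) ^ N / 2 * (2 * (1 / m ^ N) * (∫ x, w x ^ 2) -
      2 * ∑ z ∈ Z, (∫ x in cube m z, w x) ^ 2) =
      (∫ x, w x ^ 2) - m ^ N * ∑ z ∈ Z, (∫ x in cube m z, w x) ^ 2 := by
    field_simp
  rw [h8, h9] at h7
  linarith

lemma exists_finset_index_mem {s : Set (EuclideanSpace ℝ (Fin N))} (hs : Bornology.IsBounded s)
    (m : ℕ) : ∃ Z : Finset (Fin N → ℤ),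
      ∀ x ∈ s, BoxIntegral.unitPartition.index m x.ofLp ∈ Z := by
  obtain ⟨R, hR, hsR⟩ := hs.exists_pos_norm_le
  refine ⟨Fintype.piFinset fun _ => Finset.Icc (-⌈m * R⌉ - 1) ⌈m * R⌉, fun x hx => ?_⟩
  rw [Fintype.mem_piFinset]
  intro i
  have h1 : |x i| ≤ R := by simpa using (PiLp.norm_apply_le x i).trans (hsR x hx)
  have h2 := abs_le.1 h1
  rw [BoxIntegral.unitPartition.index_apply, Finset.mem_Icc]
  have hm : (0 : ℝ) ≤ m := by positivity
  have h3 : ⌈(m : ℝ) * x i⌉ ≤ ⌈m * R⌉ := Int.ceil_mono (by nlinarith)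
  have h4 : -⌈(m : ℝ) * R⌉ ≤ ⌈m * x i⌉ := by
    have h5 : -((⌈(m : ℝ) * R⌉ : ℤ) : ℝ) ≤ (⌈m * x i⌉ : ℤ) := by
      have := Int.le_ceil ((m : ℝ) * R)
      have := Int.le_ceil ((m : ℝ) * x i)
      nlinarith
    exact_mod_cast h5
  constructor <;> linarith

lemma gradient_sub {u v : EuclideanSpace ℝ (Fin N) → ℝ} (hu : ContDiff ℝ 1 u)
    (hv : ContDiff ℝ 1 v) (x : EuclideanSpace ℝ (Fin N)) :
    ∇ (fun x => u x - v x) x = ∇ u x - ∇ v x := by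
  unfold gradient
  rw [fderiv_fun_sub (hu.differentiable (by simp) x) (hv.differentiable (by simp) x), map_sub]

/-- Rellich's theorem: a sequence of `C¹` functions supported in a bounded set and bounded in the
`H¹` norm has a subsequence that is Cauchy in `L²`. -/
theorem exists_subseq_cauchy_sq {s : Set (EuclideanSpace ℝ (Fin N))} (hs : Bornology.IsBounded s)
    (φ : ℕ → EuclideanSpace ℝ (Fin N) → ℝ) (hφ : ∀ k, ContDiff ℝ 1 (φ k))
    (hφ' : ∀ k, HasCompactSupport (φ k)) (hφs : ∀ k, Function.support (φ k) ⊆ s) {M : ℝ}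
    (hM : ∀ k, ∫ x, φ k x ^ 2 ≤ M) (hM' : ∀ k, ∫ x, ‖∇ (φ k) x‖ ^ 2 ≤ M) :
    ∃ σ : ℕ → ℕ, StrictMono σ ∧ ∀ ε > 0, ∃ K, ∀ j ≥ K, ∀ k ≥ K,
      ∫ x, (φ (σ j) x - φ (σ k) x) ^ 2 < ε := by
  -- All integrals over all cubes of all mesh sizes, a countable family. They are bounded because
  -- `|φ| ≤ φ² + 1` and a cube has volume at most 1; the shift `q.1 + 1` keeps the mesh parameter
  -- nonzero.
  set X : ℕ → (ℕ × (Fin N → ℤ)) → ℝ := fun k q => ∫ x in cube (q.1 + 1) q.2, φ k x with hX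
  have hXb : ∀ k, X k ∈ Set.univ.pi fun _ : ℕ × (Fin N → ℤ) => Set.Icc (-(M + 1)) (M + 1) := by
    intro k q _
    set Q : Set (EuclideanSpace ℝ (Fin N)) := cube (q.1 + 1) q.2
    have hQ : volume Q ≠ ∞ := by simp only [Q]; rw [volume_cube]; exact ENNReal.ofReal_ne_top
    have : IsFiniteMeasure (volume.restrict Q) := ⟨by simpa using hQ.lt_top⟩
    have hQ1 : volume.real Q ≤ 1 := by
      simp only [Q]
      rw [measureReal_def, volume_cube, ENNReal.toReal_ofReal (by positivity)]
      refine (div_le_one (by positivity)).2 (one_le_pow₀ ?_)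
      push_cast
      linarith [(Nat.cast_nonneg q.1 : (0 : ℝ) ≤ q.1)]
    have hI := integrable_sq (hφ k).continuous (hφ' k)
    have h1 : |∫ x in Q, φ k x| ≤ ∫ x in Q, (φ k x ^ 2 + 1) := by
      refine abs_integral_le_integral_abs.trans ?_
      refine integral_mono
        ((hφ k).continuous.integrable_of_hasCompactSupport (hφ' k)).abs.integrableOn
        (hI.integrableOn.add (integrable_const _)) fun x => ?_
      simp only
      nlinarith [sq_nonneg (|φ k x| - 1), sq_abs (φ k x), abs_nonneg (φ k x)]
    rw [integral_add hI.integrableOn (integrable_const _)] at h1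
    have h2 : ∫ x in Q, φ k x ^ 2 ≤ M :=
      (setIntegral_le_integral hI (Eventually.of_forall fun x => sq_nonneg _)).trans (hM k)
    simp only [integral_const, MeasurableSet.univ, measureReal_restrict_apply, Set.univ_inter,
      smul_eq_mul, mul_one] at h1
    exact abs_le.1 (by linarith)
  -- Compactness of a countable product of intervals replaces the diagonal argument: along one
  -- subsequence every cube integral converges.
  obtain ⟨L, -, σ, hσ, hL⟩ := (isCompact_univ_pi fun _ : ℕ × (Fin N → ℤ) =>
    isCompact_Icc (a := -(M + 1)) (b := M + 1)).tendsto_subseq hXb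
  rw [tendsto_pi_nhds] at hL
  refine ⟨σ, hσ, fun ε hε => ?_⟩
  have hM0 : 0 ≤ M := (integral_nonneg fun x => sq_nonneg _).trans (hM 0)
  -- The mesh is fixed first, so that the gradient term is below `ε / 2`; `4 M` bounds the gradient
  -- energy of a difference. Only finitely many cube integrals then remain.
  obtain ⟨m, hm⟩ : ∃ m : ℕ, 2 ^ N * N / ((m + 1 : ℕ) : ℝ) ^ 2 * (4 * M) < ε / 2 := by
    have h1 : Tendsto (fun m : ℕ => ((m + 1 : ℕ) : ℝ)) atTop atTop :=
      tendsto_natCast_atTop_atTop.comp (tendsto_add_atTop_nat 1)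
    have h2 : Tendsto (fun m : ℕ => 2 ^ N * N / ((m + 1 : ℕ) : ℝ) ^ 2 * (4 * M)) atTop
        (𝓝 (0 * (4 * M))) :=
      (((tendsto_pow_atTop two_ne_zero).comp h1).const_div_atTop _).mul_const _
    rw [zero_mul] at h2
    exact (h2.eventually_lt_const (by linarith)).exists
  obtain ⟨Z, hZ⟩ := exists_finset_index_mem hs (m + 1)
  have hsum : Tendsto (fun q : ℕ × ℕ => ((m + 1 : ℕ) : ℝ) ^ N *
      ∑ z ∈ Z, (X (σ q.1) (m, z) - X (σ q.2) (m, z)) ^ 2) (atTop ×ˢ atTop) (𝓝 0) := by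
    have h1 : ∀ z ∈ Z, Tendsto (fun q : ℕ × ℕ => (X (σ q.1) (m, z) - X (σ q.2) (m, z)) ^ 2)
        (atTop ×ˢ atTop) (𝓝 ((L (m, z) - L (m, z)) ^ 2)) := fun z _ =>
      (((hL (m, z)).comp tendsto_fst).sub ((hL (m, z)).comp tendsto_snd)).pow 2
    have h2 := (tendsto_finsetSum Z h1).const_mul (((m + 1 : ℕ) : ℝ) ^ N)
    simpa using h2
  rw [prod_atTop_atTop_eq] at hsum
  obtain ⟨⟨K₁, K₂⟩, hK⟩ := eventually_atTop.1 (hsum.eventually_lt_const (half_pos hε))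
  refine ⟨max K₁ K₂, fun j hj k hk => ?_⟩
  have h1 := hK (j, k) ⟨(le_max_left _ _).trans hj, (le_max_right _ _).trans hk⟩
  have hw : ContDiff ℝ 1 (fun x => φ (σ j) x - φ (σ k) x) := (hφ _).sub (hφ _)
  have hw' : HasCompactSupport (fun x => φ (σ j) x - φ (σ k) x) := (hφ' _).sub (hφ' _)
  have h2 := integral_sq_le_sum_cube (m + 1) Z hw hw' (fun x hx => hZ x (by
    by_contra hxs
    have e1 : φ (σ j) x = 0 := by_contra fun h => hxs (hφs _ h)
    have e2 : φ (σ k) x = 0 := by_contra fun h => hxs (hφs _ h)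
    simp [e1, e2] at hx))
  have h3 : ∀ z, ∫ x in cube (m + 1) z, (φ (σ j) x - φ (σ k) x) =
      X (σ j) (m, z) - X (σ k) (m, z) := fun z =>
    integral_sub ((hφ _).continuous.integrable_of_hasCompactSupport (hφ' _)).integrableOn
      ((hφ _).continuous.integrable_of_hasCompactSupport (hφ' _)).integrableOn
  simp_rw [h3] at h2
  have h4 : ∫ x, ‖∇ (fun x => φ (σ j) x - φ (σ k) x) x‖ ^ 2 ≤ 4 * M := by
    have i1 := integrable_norm_gradient_sq (hφ (σ j)) (hφ' _)
    have i2 := integrable_norm_gradient_sq (hφ (σ k)) (hφ' _)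
    have : ∫ x, ‖∇ (fun x => φ (σ j) x - φ (σ k) x) x‖ ^ 2 ≤
        ∫ x, (2 * ‖∇ (φ (σ j)) x‖ ^ 2 + 2 * ‖∇ (φ (σ k)) x‖ ^ 2) := by
      refine integral_mono (integrable_norm_gradient_sq hw hw')
        ((i1.const_mul 2).add (i2.const_mul 2)) fun x => ?_
      simp only
      rw [gradient_sub (hφ _) (hφ _)]
      nlinarith [parallelogram_law_with_norm ℝ (∇ (φ (σ j)) x) (∇ (φ (σ k)) x),
        norm_nonneg (∇ (φ (σ j)) x + ∇ (φ (σ k)) x)]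
    rw [integral_add (i1.const_mul 2) (i2.const_mul 2), integral_const_mul,
      integral_const_mul] at this
    linarith [hM' (σ j), hM' (σ k)]
  have h5 : 2 ^ N * N / ((m + 1 : ℕ) : ℝ) ^ 2 *
      ∫ x, ‖∇ (fun x => φ (σ j) x - φ (σ k) x) x‖ ^ 2 ≤
      2 ^ N * N / ((m + 1 : ℕ) : ℝ) ^ 2 * (4 * M) := by gcongr
  linarith

end

end MultipolarHardy

/-! ### Concentration at a pole and sharpness of the threshold -/

namespace MultipolarHardy

noncomputable section

variable {N n : ℕ}

lemma norm_gradient_eq (u : EuclideanSpace ℝ (Fin N) → ℝ) (x : EuclideanSpace ℝ (Fin N)) :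
    ‖∇ u x‖ = ‖fderiv ℝ u x‖ := by
  rw [gradient, LinearIsometryEquiv.norm_map]

/-- In polar coordinates the integrand becomes `1 / r`. -/
lemma not_integrableOn_norm_rpow_neg_dim (hN : 3 ≤ N) {ρ : ℝ} (hρ : 0 < ρ) :
    ¬ IntegrableOn (fun x : EuclideanSpace ℝ (Fin N) => ‖x‖ ^ (-(N : ℝ))) (Metric.ball 0 ρ) := by
  have hN0 : Nontrivial (EuclideanSpace ℝ (Fin N)) := by
    have : Nonempty (Fin N) := ⟨⟨0, by omega⟩⟩
    infer_instance
  intro h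
  rw [integrableOn_fun_norm_addHaar volume (f := fun y => y ^ (-(N : ℝ)))] at h
  have h2 : IntegrableOn (fun y : ℝ => y ^ (-1 : ℝ)) (Set.Ioo 0 ρ) := by
    refine h.congr_fun (fun y hy => ?_) measurableSet_Ioo
    simp only [finrank_euclideanSpace_fin, smul_eq_mul]
    rw [← Real.rpow_natCast, ← Real.rpow_add hy.1, Nat.cast_sub (by omega)]
    congr 1; push_cast; ring
  rw [intervalIntegral.integrableOn_Ioo_rpow_iff hρ] at h2
  exact lt_irrefl _ h2

/-- The mass `∫ η² r² (r² + ε)^(-α-2)` with `α = (N - 2) / 2` blows up as `ε → 0`. -/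
lemma exists_lt_integral_regularized (hN : 3 ≤ N) (p : EuclideanSpace ℝ (Fin N))
    (η : ContDiffBump p) (B : ℝ) :
    ∃ ε : ℝ, 0 < ε ∧ B < ∫ x, η x ^ 2 *
      (‖x - p‖ ^ 2 * (‖x - p‖ ^ 2 + ε) ^ (-(((N : ℝ) - 2) / 2) - 2)) := by
  set α : ℝ := ((N : ℝ) - 2) / 2 with hα
  -- A bound uniform in `ε` would, by Fatou's lemma along `ε = 1 / (k + 1)`, make `|x - p|^(-N)`
  -- integrable near `p`.
  by_contra hcon
  push Not at hcon
  set ε : ℕ → ℝ := fun k => 1 / ((k : ℝ) + 1) with hε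
  have hεpos : ∀ k, 0 < ε k := fun k => by positivity
  have hεlim : Tendsto ε atTop (𝓝 0) := tendsto_one_div_add_atTop_nhds_zero_nat
  set f : ℕ → EuclideanSpace ℝ (Fin N) → ℝ := fun k x =>
    η x ^ 2 * (‖x - p‖ ^ 2 * (‖x - p‖ ^ 2 + ε k) ^ (-α - 2)) with hf
  have hfc : ∀ k, Continuous (f k) := fun k => by
    have h1 : Continuous fun x : EuclideanSpace ℝ (Fin N) => (‖x - p‖ ^ 2 + ε k) ^ (-α - 2) :=
      Continuous.rpow_const (by fun_prop) fun x => Or.inl (by have := hεpos k; positivity)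
    have := η.continuous
    fun_prop
  have hfs : ∀ k, HasCompactSupport (f k) := fun k =>
    (η.hasCompactSupport.comp_left (g := fun y : ℝ => y ^ 2) (by simp)).mul_right
  have hf0 : ∀ k x, 0 ≤ f k x := fun k x => by have := hεpos k; positivity
  have hfi : ∀ k, ∫⁻ x, ENNReal.ofReal (f k x) ≤ ENNReal.ofReal B := fun k => by
    rw [← ofReal_integral_eq_lintegral_ofReal ((hfc k).integrable_of_hasCompactSupport (hfs k))
      (Eventually.of_forall (hf0 k))]
    exact ENNReal.ofReal_le_ofReal (hcon (ε k) (hεpos k))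
  have hN0 : Nontrivial (EuclideanSpace ℝ (Fin N)) := by
    have : Nonempty (Fin N) := ⟨⟨0, by omega⟩⟩
    infer_instance
  have hlim : ∀ᵐ x ∂volume.restrict (Metric.ball p η.rIn),
      ENNReal.ofReal (‖x - p‖ ^ (-(N : ℝ))) = liminf (fun k => ENNReal.ofReal (f k x)) atTop := by
    have hne : ∀ᵐ x ∂volume.restrict (Metric.ball p η.rIn), x ≠ p := by
      refine ae_restrict_of_ae ?_
      simp [ae_iff, measure_singleton]
    filter_upwards [hne, ae_restrict_mem measurableSet_ball] with x hx hxb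
    refine (Tendsto.liminf_eq ?_).symm
    refine ENNReal.tendsto_ofReal ?_
    have hη : η x = 1 := η.one_of_mem_closedBall (Metric.ball_subset_closedBall hxb)
    have hr : 0 < ‖x - p‖ := by have := sub_ne_zero.2 hx; positivity
    have h1 : Tendsto (fun k => ‖x - p‖ ^ 2 + ε k) atTop (𝓝 (‖x - p‖ ^ 2)) := by
      simpa using hεlim.const_add (‖x - p‖ ^ 2)
    have h2 := (h1.rpow_const (p := -α - 2) (Or.inl (by positivity))).const_mul (‖x - p‖ ^ 2)
    have h3 : ‖x - p‖ ^ 2 * (‖x - p‖ ^ 2) ^ (-α - 2) = ‖x - p‖ ^ (-(N : ℝ)) := by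
      rw [← Real.rpow_natCast, ← Real.rpow_mul hr.le, ← Real.rpow_add hr, hα]
      congr 1; push_cast; ring
    rw [h3] at h2
    simpa [hf, hη] using h2
  have hfin : ∫⁻ x in Metric.ball p η.rIn, ENNReal.ofReal (‖x - p‖ ^ (-(N : ℝ))) ≤
      ENNReal.ofReal B := by
    rw [lintegral_congr_ae hlim]
    refine (lintegral_liminf_le fun k =>
      (ENNReal.continuous_ofReal.comp (hfc k)).measurable).trans ?_
    refine liminf_le_of_frequently_le' (Frequently.of_forall fun k => ?_)
    exact (setLIntegral_le_lintegral _ _).trans (hfi k)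
  have hIntOn : IntegrableOn (fun x => ‖x - p‖ ^ (-(N : ℝ))) (Metric.ball p η.rIn) := by
    refine ⟨(by fun_prop : Measurable _).aestronglyMeasurable, ?_⟩
    rw [hasFiniteIntegral_iff_ofReal (Eventually.of_forall fun x => by positivity)]
    exact hfin.trans_lt ENNReal.ofReal_lt_top
  refine not_integrableOn_norm_rpow_neg_dim hN η.rIn_pos ?_
  rw [← integrable_indicator_iff measurableSet_ball] at hIntOn ⊢
  refine (hIntOn.comp_add_right p).congr (Eventually.of_forall fun x => ?_)
  simp [Set.indicator, Metric.mem_ball, dist_eq_norm]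

lemma add_sq_le_mul_add {θ : ℝ} (hθ : 0 < θ) (s t : ℝ) :
    (s + t) ^ 2 ≤ (1 + θ) * s ^ 2 + (1 + θ⁻¹) * t ^ 2 := by
  have h1 : (1 + θ) * s ^ 2 + (1 + θ⁻¹) * t ^ 2 - (s + t) ^ 2 = θ⁻¹ * (θ * s - t) ^ 2 := by
    field_simp; ring
  have h2 : 0 ≤ θ⁻¹ * (θ * s - t) ^ 2 := by positivity
  linarith

/-- Functions concentrated near `p` almost violate the Hardy inequality with one pole. -/
lemma exists_concentrated (hN : 3 ≤ N) (p : EuclideanSpace ℝ (Fin N)) {ρ κ : ℝ} (hρ : 0 < ρ)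
    (hκ : 0 < κ) :
    ∃ u : EuclideanSpace ℝ (Fin N) → ℝ, ContDiff ℝ (⊤ : ℕ∞) u ∧ HasCompactSupport u ∧
      tsupport u ⊆ Metric.ball p ρ ∧
      ∫ x, ‖∇ u x‖ ^ 2 < ((((N : ℝ) - 2) / 2) ^ 2 + κ) * ∫ x, (‖x - p‖ ^ 2)⁻¹ * u x ^ 2 := by
  set α : ℝ := ((N : ℝ) - 2) / 2 with hα
  have hα0 : 0 < α := by
    have hN' : (3 : ℝ) ≤ N := by exact_mod_cast hN
    rw [hα]; linarith
  let η : ContDiffBump p := ⟨ρ / 4, ρ / 2, by positivity, by linarith⟩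
  -- Chosen so that `(1 + θ) α² = α² + κ / 2`; the other half of `κ` absorbs the cutoff term.
  set θ : ℝ := κ / 2 / α ^ 2 with hθ
  have hθ0 : 0 < θ := by positivity
  have hηC : ContDiff ℝ (⊤ : ℕ∞) η := η.contDiff
  have hη1 : ContDiff ℝ 1 η := η.contDiff
  have hηd : Continuous (fderiv ℝ η) := hη1.continuous_fderiv (by simp)
  have hJ : Integrable (fun x => ‖fderiv ℝ η x‖ ^ 2) := by
    simpa [norm_gradient_eq] using integrable_norm_gradient_sq hη1 η.hasCompactSupport
  set G : ℝ := ((ρ / 4) ^ 2) ^ (-α) with hG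
  -- `κ / 2 * B` is the bound for the cutoff term, independent of `ε`; mass above `B` therefore
  -- outweighs it.
  set B : ℝ := (2 / κ) * ((1 + θ⁻¹) * G * ∫ x, ‖fderiv ℝ η x‖ ^ 2) with hB
  obtain ⟨ε, hε, hI⟩ := exists_lt_integral_regularized hN p η B
  -- A smooth regularisation of `|x - p|^(-α)`, the virtual extremal of the one-pole Hardy
  -- inequality.
  set g : EuclideanSpace ℝ (Fin N) → ℝ := fun x => (‖x - p‖ ^ 2 + ε) ^ (-α / 2) with hg
  have hpos : ∀ x : EuclideanSpace ℝ (Fin N), 0 < ‖x - p‖ ^ 2 + ε := fun x => by positivity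
  have hgC : ContDiff ℝ (⊤ : ℕ∞) g := by
    refine ContDiff.rpow_const_of_ne ?_ fun x => (hpos x).ne'
    exact ((contDiff_id.sub contDiff_const).norm_sq ℝ).add contDiff_const
  have hgd : ∀ x, HasFDerivAt g
      ((-α * (‖x - p‖ ^ 2 + ε) ^ (-α / 2 - 1)) • (innerSL ℝ (x - p))) x := by
    intro x
    have h1 : HasFDerivAt (fun x : EuclideanSpace ℝ (Fin N) => ‖x - p‖ ^ 2 + ε)
        (2 • (innerSL ℝ (x - p))) x := by
      have := ((hasFDerivAt_id x).sub_const p).norm_sq.add_const ε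
      simpa using this
    have h2 := h1.rpow_const (p := -α / 2) (Or.inl (hpos x).ne')
    rw [← Nat.cast_smul_eq_nsmul ℝ, smul_smul] at h2
    rw [show -α * (‖x - p‖ ^ 2 + ε) ^ (-α / 2 - 1) =
      -α / 2 * (‖x - p‖ ^ 2 + ε) ^ (-α / 2 - 1) * ((2 : ℕ) : ℝ) by push_cast; ring]
    exact h2
  set u : EuclideanSpace ℝ (Fin N) → ℝ := fun x => η x * g x with hu
  have huC : ContDiff ℝ (⊤ : ℕ∞) u := hηC.mul hgC
  have hu1 : ContDiff ℝ 1 u := huC.of_le (by exact_mod_cast le_top)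
  have huS : HasCompactSupport u := η.hasCompactSupport.mul_right
  refine ⟨u, huC, huS, ?_, ?_⟩
  · refine (closure_mono (Function.support_mul_subset_left (η : _ → ℝ) g)).trans ?_
    rw [← tsupport, η.tsupport_eq]
    exact Metric.closedBall_subset_ball (by simp only [η]; linarith)
  set I : EuclideanSpace ℝ (Fin N) → ℝ :=
    fun x => η x ^ 2 * (‖x - p‖ ^ 2 * (‖x - p‖ ^ 2 + ε) ^ (-α - 2)) with hIdef
  have hIc : Continuous I := by
    have h1 : Continuous fun x : EuclideanSpace ℝ (Fin N) => (‖x - p‖ ^ 2 + ε) ^ (-α - 2) :=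
      Continuous.rpow_const (by fun_prop) fun x => Or.inl (hpos x).ne'
    have := η.continuous
    fun_prop
  have hIi : Integrable I := hIc.integrable_of_hasCompactSupport
    (η.hasCompactSupport.comp_left (g := fun y : ℝ => y ^ 2) (by simp)).mul_right
  have hg2 : ∀ x, g x ^ 2 = (‖x - p‖ ^ 2 + ε) ^ (-α) := fun x => by
    rw [hg, ← Real.rpow_natCast, ← Real.rpow_mul (hpos x).le]
    congr 1; push_cast; ring
  have hgrad : ∀ x, ‖∇ u x‖ ^ 2 ≤ (α ^ 2 + κ / 2) * I x +
      (1 + θ⁻¹) * G * ‖fderiv ℝ η x‖ ^ 2 := by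
    intro x
    have hηx : HasFDerivAt η (fderiv ℝ η x) x :=
      (hη1.differentiable (by simp) x).hasFDerivAt
    have h1 : HasFDerivAt u _ x := hηx.mul (hgd x)
    rw [norm_gradient_eq, h1.fderiv]
    have h2 := pow_le_pow_left₀ (norm_nonneg _) (norm_add_le
      (η x • (-α * (‖x - p‖ ^ 2 + ε) ^ (-α / 2 - 1)) • innerSL ℝ (x - p))
      (g x • fderiv ℝ η x)) 2
    refine h2.trans ((add_sq_le_mul_add hθ0 _ _).trans ?_)
    have e1 : ‖η x • (-α * (‖x - p‖ ^ 2 + ε) ^ (-α / 2 - 1)) • innerSL ℝ (x - p)‖ ^ 2 =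
        α ^ 2 * I x := by
      rw [norm_smul, norm_smul, innerSL_apply_norm, mul_pow, mul_pow, Real.norm_eq_abs,
        Real.norm_eq_abs, sq_abs, sq_abs, mul_pow, ← Real.rpow_natCast (_ ^ (-α / 2 - 1)),
        ← Real.rpow_mul (hpos x).le, hIdef,
        show (-α / 2 - 1) * ((2 : ℕ) : ℝ) = -α - 2 by push_cast; ring]
      ring
    have e2 : ‖g x • fderiv ℝ η x‖ ^ 2 ≤ G * ‖fderiv ℝ η x‖ ^ 2 := by
      rw [norm_smul, mul_pow, Real.norm_eq_abs, sq_abs, hg2]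
      -- The cutoff is constant on the inner ball, and outside it `g² ≤ G` whatever `ε` is.
      by_cases hxb : x ∈ Metric.ball p (ρ / 4)
      · have : fderiv ℝ η x = 0 := by
          have h3 : (η : _ → ℝ) =ᶠ[𝓝 x] fun _ => 1 := by
            filter_upwards [Metric.isOpen_ball.mem_nhds hxb] with y hy
            exact η.one_of_mem_closedBall (Metric.ball_subset_closedBall hy)
          rw [h3.fderiv_eq]; simp
        simp [this]
      · have h3 : ρ / 4 ≤ ‖x - p‖ := by
          rwa [Metric.mem_ball, not_lt, dist_eq_norm] at hxb
        gcongr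
        refine Real.rpow_le_rpow_of_nonpos (by positivity) ?_ (by linarith)
        nlinarith
    have e3 : (1 + θ) * (α ^ 2 * I x) = (α ^ 2 + κ / 2) * I x := by
      rw [hθ]; field_simp
    rw [e1, e3, mul_assoc (1 + θ⁻¹)]
    gcongr
  have h1 : ∫ x, ‖∇ u x‖ ^ 2 ≤ (α ^ 2 + κ / 2) * (∫ x, I x) +
      (1 + θ⁻¹) * G * ∫ x, ‖fderiv ℝ η x‖ ^ 2 := by
    rw [← integral_const_mul, ← integral_const_mul,
      ← integral_add (hIi.const_mul _) (hJ.const_mul _)]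
    exact integral_mono (integrable_norm_gradient_sq hu1 huS)
      ((hIi.const_mul _).add (hJ.const_mul _)) hgrad
  have h2 : ∫ x, I x ≤ ∫ x, (‖x - p‖ ^ 2)⁻¹ * u x ^ 2 := by
    refine integral_mono_ae hIi (integrable_inv_norm_sq_mul hN p (hu1.continuous.pow 2)
      (hasCompactSupport_sq huS)) ?_
    have hN0 : Nontrivial (EuclideanSpace ℝ (Fin N)) := by
      have : Nonempty (Fin N) := ⟨⟨0, by omega⟩⟩
      infer_instance
    have hne : ∀ᵐ x : EuclideanSpace ℝ (Fin N), x ≠ p := by simp [ae_iff, measure_singleton]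
    filter_upwards [hne] with x hx
    have hr : 0 < ‖x - p‖ ^ 2 := by have := sub_ne_zero.2 hx; positivity
    have e : I x = η x ^ 2 * (‖x - p‖ ^ 2 + ε) ^ (-α) *
        (‖x - p‖ ^ 2 * ((‖x - p‖ ^ 2 + ε) ^ 2)⁻¹) := by
      simp only [hIdef]
      rw [Real.rpow_sub (hpos x), Real.rpow_two]; ring
    simp only [hu]
    rw [e, mul_pow, hg2, mul_comm (‖x - p‖ ^ 2)⁻¹]
    have := (hpos x).le
    gcongr
    rw [← div_eq_mul_inv, inv_eq_one_div, div_le_div_iff₀ (by positivity) hr]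
    nlinarith
  have h3 : (1 + θ⁻¹) * G * ∫ x, ‖fderiv ℝ η x‖ ^ 2 < κ / 2 * ∫ x, I x := by
    have h4 : (1 + θ⁻¹) * G * ∫ x, ‖fderiv ℝ η x‖ ^ 2 = κ / 2 * B := by
      rw [hB]; field_simp
    rw [h4]
    gcongr
  have h4 : (α ^ 2 + κ) * (∫ x, I x) ≤ (α ^ 2 + κ) * ∫ x, (‖x - p‖ ^ 2)⁻¹ * u x ^ 2 := by gcongr
  linarith

/-- Above the threshold no lower bound holds. -/
lemma exists_lt_above_threshold (hN : 3 ≤ N) (hn : 2 ≤ n)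
    (Ω : Opens (EuclideanSpace ℝ (Fin N))) (a : Fin n → EuclideanSpace ℝ (Fin N))
    (ha : Function.Injective a) (haΩ : ∀ i, a i ∈ Ω) {μ : ℝ}
    (hμ : ((N : ℝ) - 2) ^ 2 / (4 * n - 4) < μ) (c : ℝ) : ∃ u : 𝓓(Ω, ℝ),
      c * (∫ x, u x ^ 2) + (∫ x, ‖∇ (u : EuclideanSpace ℝ (Fin N) → ℝ) x‖ ^ 2) <
        μ * ∫ x, potential a x * u x ^ 2 := by
  have hn' : (2 : ℝ) ≤ n := by exact_mod_cast hn
  -- With the first pole, all `n - 1` pairs containing it appear in the sum as `i < j`.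
  set i : Fin n := ⟨0, by omega⟩ with hi
  set α : ℝ := ((N : ℝ) - 2) / 2 with hα
  have hμ0 : 0 < μ := lt_of_le_of_lt (div_nonneg (sq_nonneg _) (by linarith)) hμ
  have hμ1 : α ^ 2 < μ * (n - 1) := by
    rw [div_lt_iff₀ (by linarith)] at hμ
    rw [hα]; nlinarith
  set κ : ℝ := (μ * (n - 1) - α ^ 2) / 2 with hκ
  have hκ0 : 0 < κ := by rw [hκ]; linarith
  -- `W` is a lower bound for `|x - aᵢ|² (μ V - c)` that is continuous at the pole, where its value
  -- `μ (n - 1)` exceeds `α² + κ`.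
  set W : EuclideanSpace ℝ (Fin N) → ℝ := fun x =>
    μ * (∑ j ∈ Finset.Ioi i, ‖a i - a j‖ ^ 2 / ‖x - a j‖ ^ 2) - |c| * ‖x - a i‖ ^ 2 with hW
  have hj : ∀ j ∈ Finset.Ioi i, ‖a i - a j‖ ^ 2 ≠ 0 := by
    intro j hj
    have : a i ≠ a j := ha.ne (Finset.mem_Ioi.1 hj).ne
    simpa [sub_eq_zero] using this
  have hWc : ContinuousAt W (a i) := by
    refine ContinuousAt.sub (ContinuousAt.mul continuousAt_const ?_) (by fun_prop)
    exact tendsto_finsetSum _ fun j hjm =>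
      ContinuousAt.div continuousAt_const (by fun_prop) (hj j hjm)
  have hWv : W (a i) = μ * (n - 1) := by
    simp only [hW, sub_self, norm_zero]
    rw [Finset.sum_congr rfl fun j hjm => div_self (hj j hjm)]
    simp [hi, Fin.card_Ioi, Nat.cast_sub (by omega : 1 ≤ n)]
  have hev : ∀ᶠ x in 𝓝 (a i), x ∈ Ω ∧ α ^ 2 + κ < W x :=
    Eventually.and (Ω.isOpen.mem_nhds (haΩ i))
      (hWc.eventually_const_lt (by rw [hWv, hκ]; linarith))
  obtain ⟨ρ, hρ, hball⟩ := Metric.eventually_nhds_iff_ball.1 hev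
  obtain ⟨u, huC, huS, hut, hlt⟩ := exists_concentrated hN (a i) hρ hκ0
  rw [← hα] at hlt
  have hu1 : ContDiff ℝ 1 u := huC.of_le (by exact_mod_cast le_top)
  refine ⟨⟨u, huC, huS, fun x hx => (hball x (hut hx)).1⟩, ?_⟩
  change c * (∫ x, u x ^ 2) + (∫ x, ‖∇ u x‖ ^ 2) < μ * ∫ x, potential a x * u x ^ 2
  have hV := integrable_potential_mul_sq hN a hu1.continuous huS
  have hI := integrable_sq hu1.continuous huS
  have h1 : (α ^ 2 + κ) * (∫ x, (‖x - a i‖ ^ 2)⁻¹ * u x ^ 2) ≤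
      μ * (∫ x, potential a x * u x ^ 2) - c * ∫ x, u x ^ 2 := by
    rw [← integral_const_mul, ← integral_const_mul, ← integral_const_mul,
      ← integral_sub (hV.const_mul _) (hI.const_mul _)]
    refine integral_mono_ae ((integrable_inv_norm_sq_mul hN (a i) (g := fun x => u x ^ 2)
      (hu1.continuous.pow 2) (hasCompactSupport_sq huS)).const_mul _)
      ((hV.const_mul _).sub (hI.const_mul _)) ?_
    filter_upwards [ae_notMem_range hN a] with x hx
    rcases eq_or_ne (u x) 0 with h0 | h0
    · simp [h0]
    have hxW := (hball x (hut (subset_tsupport _ h0))).2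
    have hr : 0 < ‖x - a i‖ ^ 2 := by have := sub_ne_zero.2 (hx i); positivity
    have h2 : (‖x - a i‖ ^ 2)⁻¹ * ∑ j ∈ Finset.Ioi i, ‖a i - a j‖ ^ 2 / ‖x - a j‖ ^ 2 ≤
        potential a x := by
      unfold potential
      refine le_trans (le_of_eq ?_) (Finset.single_le_sum
        (f := fun i => ∑ j ∈ Finset.Ioi i, ‖a i - a j‖ ^ 2 / (‖x - a i‖ ^ 2 * ‖x - a j‖ ^ 2))
        (fun k _ => Finset.sum_nonneg fun l _ => by positivity) (Finset.mem_univ i))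
      rw [Finset.mul_sum]
      refine Finset.sum_congr rfl fun j _ => ?_
      rw [div_mul_eq_div_div_swap, div_eq_mul_inv _ (‖x - a i‖ ^ 2), mul_comm]
    have h3 : (α ^ 2 + κ) * (‖x - a i‖ ^ 2)⁻¹ ≤ μ * potential a x - c := by
      calc (α ^ 2 + κ) * (‖x - a i‖ ^ 2)⁻¹ ≤ W x * (‖x - a i‖ ^ 2)⁻¹ := by gcongr
        _ = μ * ((‖x - a i‖ ^ 2)⁻¹ * ∑ j ∈ Finset.Ioi i, ‖a i - a j‖ ^ 2 / ‖x - a j‖ ^ 2) -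
              |c| := by
            simp only [hW]; rw [sub_mul, mul_assoc |c|, mul_inv_cancel₀ hr.ne']; ring
        _ ≤ μ * potential a x - c := by
            have := le_abs_self c
            have := mul_le_mul_of_nonneg_left h2 hμ0.le
            linarith
    calc (α ^ 2 + κ) * ((‖x - a i‖ ^ 2)⁻¹ * u x ^ 2)
        = (α ^ 2 + κ) * (‖x - a i‖ ^ 2)⁻¹ * u x ^ 2 := by ring
      _ ≤ (μ * potential a x - c) * u x ^ 2 := by gcongr
      _ = _ := by ring
  linarith

end

end MultipolarHardy

/-! ### `L²` limits, test functions and their closures -/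

namespace MultipolarHardy

noncomputable section

variable {N n : ℕ} {Ω : Opens (EuclideanSpace ℝ (Fin N))}

section Lp

variable {X F : Type*} [MeasurableSpace X] [NormedAddCommGroup F] {ν : Measure X}

lemma eLpNorm_two_sq (f : X → F) :
    eLpNorm f 2 ν ^ 2 = ∫⁻ x, ENNReal.ofReal (‖f x‖ ^ 2) ∂ν := by
  have h := eLpNorm_nnreal_pow_eq_lintegral (f := f) (μ := ν) (p := 2) two_ne_zero
  have h2 : ∀ x, ENNReal.ofReal (‖f x‖ ^ 2) = ‖f x‖ₑ ^ 2 := fun x => by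
    rw [ENNReal.ofReal_pow (norm_nonneg _), ofReal_norm]
  simp_rw [h2]
  simpa using h

lemma lintegral_norm_sq_ne_top {f : X → F} (hf : MemLp f 2 ν) :
    ∫⁻ x, ENNReal.ofReal (‖f x‖ ^ 2) ∂ν ≠ ∞ := by
  rw [← eLpNorm_two_sq]
  exact ENNReal.pow_ne_top hf.eLpNorm_ne_top

lemma tendsto_lintegral_norm_sq {f : ℕ → X → F} {g : X → F}
    (hf : ∀ k, AEStronglyMeasurable (f k) ν) (hg : MemLp g 2 ν)
    (h : Tendsto (fun k => eLpNorm (fun x => f k x - g x) 2 ν) atTop (𝓝 0)) :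
    Tendsto (fun k => ∫⁻ x, ENNReal.ofReal (‖f k x‖ ^ 2) ∂ν) atTop
      (𝓝 (∫⁻ x, ENNReal.ofReal (‖g x‖ ^ 2) ∂ν)) := by
  simp_rw [← eLpNorm_two_sq]
  refine ENNReal.Tendsto.pow ?_
  have h1 : ∀ k, eLpNorm (f k) 2 ν ≤ eLpNorm g 2 ν + eLpNorm (fun x => f k x - g x) 2 ν := by
    intro k
    have := eLpNorm_add_le (μ := ν) (p := 2) hg.1 ((hf k).sub hg.1) (by norm_num)
    rwa [add_sub_cancel] at this
  have h2 : ∀ k, eLpNorm g 2 ν - eLpNorm (fun x => f k x - g x) 2 ν ≤ eLpNorm (f k) 2 ν := by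
    intro k
    rw [tsub_le_iff_right]
    have := eLpNorm_add_le (μ := ν) (p := 2) (hf k) (hg.1.sub (hf k)) (by norm_num)
    have e : eLpNorm (g - f k) 2 ν = eLpNorm (fun x => f k x - g x) 2 ν := by
      rw [← eLpNorm_neg, neg_sub]; rfl
    rw [e] at this
    simpa [add_sub_cancel] using this
  refine tendsto_of_tendsto_of_tendsto_of_le_of_le ?_ ?_ h2 h1
  · simpa using ENNReal.Tendsto.sub (tendsto_const_nhds (x := eLpNorm g 2 ν)) h
      (Or.inl hg.eLpNorm_ne_top)
  · simpa using (tendsto_const_nhds (x := eLpNorm g 2 ν)).add h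

lemma exists_limit_of_cauchy_sq [CompleteSpace F] {f : ℕ → X → F} (hf : ∀ k, MemLp (f k) 2 ν)
    (h : ∀ ε > 0, ∃ K, ∀ j ≥ K, ∀ k ≥ K, ∫ x, ‖f j x - f k x‖ ^ 2 ∂ν < ε) :
    ∃ g, MemLp g 2 ν ∧ Tendsto (fun k => eLpNorm (fun x => f k x - g x) 2 ν) atTop (𝓝 0) := by
  have hc : CauchySeq (fun k => (hf k).toLp (f k)) := by
    rw [Metric.cauchySeq_iff]
    intro ε hε
    obtain ⟨K, hK⟩ := h (ε ^ 2) (by positivity)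
    refine ⟨K, fun j hj k hk => ?_⟩
    have h1 := hK j hj k hk
    rw [dist_eq_norm, ← MemLp.toLp_sub, Lp.norm_toLp]
    have hi : Integrable (fun x => ‖f j x - f k x‖ ^ 2) ν := ((hf j).sub (hf k)).integrable_norm_pow
      (p := 2) two_ne_zero
    have h2 : eLpNorm (f j - f k) 2 ν ^ 2 < ENNReal.ofReal ε ^ 2 := by
      rw [eLpNorm_two_sq, ← ENNReal.ofReal_pow hε.le]
      simp only [Pi.sub_apply]
      rw [← ofReal_integral_eq_lintegral_ofReal hi (Eventually.of_forall fun x => by positivity)]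
      exact (ENNReal.ofReal_lt_ofReal_iff (by positivity)).2 h1
    have h3 : eLpNorm (f j - f k) 2 ν < ENNReal.ofReal ε :=
      lt_of_not_ge fun hle => absurd (pow_le_pow_left' hle 2) (not_le.2 h2)
    exact (ENNReal.lt_ofReal_iff_toReal_lt ((hf j).sub (hf k)).eLpNorm_ne_top).1 h3
  obtain ⟨g, hg⟩ := cauchySeq_tendsto_of_complete hc
  refine ⟨g, Lp.memLp g, ?_⟩
  rw [← Lp.toLp_coeFn g (Lp.memLp g), Lp.tendsto_Lp_iff_tendsto_eLpNorm''] at hg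
  exact hg

end Lp

section TestFunction

lemma contDiff_one (φ : 𝓓(Ω, ℝ)) : ContDiff ℝ 1 (φ : EuclideanSpace ℝ (Fin N) → ℝ) :=
  φ.contDiff.of_le (by exact_mod_cast le_top)

lemma support_subset (φ : 𝓓(Ω, ℝ)) :
    Function.support (φ : EuclideanSpace ℝ (Fin N) → ℝ) ⊆ Ω :=
  (subset_tsupport _).trans φ.tsupport_subset

lemma apply_eq_zero (φ : 𝓓(Ω, ℝ)) {x : EuclideanSpace ℝ (Fin N)} (hx : x ∉ Ω) : φ x = 0 :=
  by_contra fun h => hx (support_subset φ h)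

lemma gradient_eq_zero (φ : 𝓓(Ω, ℝ)) {x : EuclideanSpace ℝ (Fin N)} (hx : x ∉ Ω) :
    ∇ (φ : EuclideanSpace ℝ (Fin N) → ℝ) x = 0 := by
  have h : x ∉ tsupport (φ : EuclideanSpace ℝ (Fin N) → ℝ) := fun h => hx (φ.tsupport_subset h)
  rw [gradient, fderiv_of_notMem_tsupport ℝ h, map_zero]

lemma setIntegral_mul_sq (φ : 𝓓(Ω, ℝ)) (W : EuclideanSpace ℝ (Fin N) → ℝ) :
    ∫ x in Ω, W x * φ x ^ 2 = ∫ x, W x * φ x ^ 2 :=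
  setIntegral_eq_integral_of_forall_compl_eq_zero fun x hx => by simp [apply_eq_zero φ hx]

lemma setIntegral_sq (φ : 𝓓(Ω, ℝ)) : ∫ x in Ω, φ x ^ 2 = ∫ x, φ x ^ 2 := by
  simpa using setIntegral_mul_sq φ fun _ => 1

lemma setIntegral_gradient_sq (φ : 𝓓(Ω, ℝ)) :
    ∫ x in Ω, ‖∇ (φ : EuclideanSpace ℝ (Fin N) → ℝ) x‖ ^ 2 =
      ∫ x, ‖∇ (φ : EuclideanSpace ℝ (Fin N) → ℝ) x‖ ^ 2 :=
  setIntegral_eq_integral_of_forall_compl_eq_zero fun x hx => by simp [gradient_eq_zero φ hx]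

lemma setLIntegral_gradient_sq (φ : 𝓓(Ω, ℝ)) :
    ∫⁻ x in Ω, ENNReal.ofReal (‖∇ (φ : EuclideanSpace ℝ (Fin N) → ℝ) x‖ ^ 2) =
      ENNReal.ofReal (∫ x, ‖∇ (φ : EuclideanSpace ℝ (Fin N) → ℝ) x‖ ^ 2) := by
  rw [← setIntegral_gradient_sq, ofReal_integral_eq_lintegral_ofReal
    (integrable_norm_gradient_sq (contDiff_one φ) φ.hasCompactSupport).integrableOn
    (Eventually.of_forall fun x => by positivity)]

lemma setLIntegral_mul_sq (φ : 𝓓(Ω, ℝ)) {W : EuclideanSpace ℝ (Fin N) → ℝ} (hW : ∀ x, 0 ≤ W x)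
    (hφ : Integrable fun x => W x * φ x ^ 2) :
    ∫⁻ x in Ω, ENNReal.ofReal (W x * φ x ^ 2) = ENNReal.ofReal (∫ x, W x * φ x ^ 2) := by
  rw [← setIntegral_mul_sq, ofReal_integral_eq_lintegral_ofReal hφ.integrableOn
    (Eventually.of_forall fun x => mul_nonneg (hW x) (sq_nonneg _))]

lemma integrable_potential_mul_testFunction_sq (hN : 3 ≤ N)
    (a : Fin n → EuclideanSpace ℝ (Fin N)) (φ : 𝓓(Ω, ℝ)) :
    Integrable fun x => potential a x * φ x ^ 2 :=
  integrable_potential_mul_sq hN a φ.continuous φ.hasCompactSupport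

lemma memLp_testFunction (φ : 𝓓(Ω, ℝ)) (p : ℝ≥0∞) (ν : Measure (EuclideanSpace ℝ (Fin N)))
    [IsFiniteMeasureOnCompacts ν] : MemLp φ p ν :=
  φ.continuous.memLp_of_hasCompactSupport φ.hasCompactSupport

lemma memLp_gradient (φ : 𝓓(Ω, ℝ)) (p : ℝ≥0∞) (ν : Measure (EuclideanSpace ℝ (Fin N)))
    [IsFiniteMeasureOnCompacts ν] : MemLp (∇ (φ : EuclideanSpace ℝ (Fin N) → ℝ)) p ν :=
  (continuous_gradient (contDiff_one φ)).memLp_of_hasCompactSupport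
    (hasCompactSupport_gradient φ.hasCompactSupport)

lemma memClosure_testFunction (φ : 𝓓(Ω, ℝ)) (p : ℝ≥0∞) :
    MemClosure p Ω φ (∇ (φ : EuclideanSpace ℝ (Fin N) → ℝ)) where
  memLp := memLp_testFunction φ p _
  memLp_grad := memLp_gradient φ 2 _
  approx := ⟨fun _ => φ, by simp⟩

lemma gradient_smul (φ : 𝓓(Ω, ℝ)) (c : ℝ) (x : EuclideanSpace ℝ (Fin N)) :
    ∇ ((c • φ : 𝓓(Ω, ℝ)) : EuclideanSpace ℝ (Fin N) → ℝ) x =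
      c • ∇ (φ : EuclideanSpace ℝ (Fin N) → ℝ) x := by
  have h : ((c • φ : 𝓓(Ω, ℝ)) : EuclideanSpace ℝ (Fin N) → ℝ) = c • (φ : _ → ℝ) := rfl
  rw [h, gradient, fderiv_const_smul ((contDiff_one φ).differentiable (by simp) x),
    map_smul, gradient]

lemma gradient_coe_sub (φ ψ : 𝓓(Ω, ℝ)) (x : EuclideanSpace ℝ (Fin N)) :
    ∇ ((φ - ψ : 𝓓(Ω, ℝ)) : EuclideanSpace ℝ (Fin N) → ℝ) x =
      ∇ (φ : EuclideanSpace ℝ (Fin N) → ℝ) x - ∇ (ψ : EuclideanSpace ℝ (Fin N) → ℝ) x :=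
  gradient_sub (contDiff_one φ) (contDiff_one ψ) x

lemma gradient_coe_add (φ ψ : 𝓓(Ω, ℝ)) (x : EuclideanSpace ℝ (Fin N)) :
    ∇ ((φ + ψ : 𝓓(Ω, ℝ)) : EuclideanSpace ℝ (Fin N) → ℝ) x =
      ∇ (φ : EuclideanSpace ℝ (Fin N) → ℝ) x + ∇ (ψ : EuclideanSpace ℝ (Fin N) → ℝ) x := by
  have h : ((φ + ψ : 𝓓(Ω, ℝ)) : EuclideanSpace ℝ (Fin N) → ℝ) =
    (φ : _ → ℝ) + (ψ : _ → ℝ) := rfl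
  rw [h, gradient, fderiv_add ((contDiff_one φ).differentiable (by simp) x)
    ((contDiff_one ψ).differentiable (by simp) x), map_add, gradient, gradient]

end TestFunction

section Closure

/-- `L^p` convergence gives convergence in measure, hence almost everywhere along a subsequence: the
form that Fatou's lemma needs. -/
lemma MemClosure.exists_seq {p : ℝ≥0∞} (hp : p ≠ 0) {u : EuclideanSpace ℝ (Fin N) → ℝ}
    {g : EuclideanSpace ℝ (Fin N) → EuclideanSpace ℝ (Fin N)} (h : MemClosure p Ω u g) :
    ∃ φ : ℕ → 𝓓(Ω, ℝ),
      (∀ᵐ x ∂volume.restrict (Ω : Set (EuclideanSpace ℝ (Fin N))),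
        Tendsto (fun k => φ k x) atTop (𝓝 (u x))) ∧
      Tendsto (fun k => ENNReal.ofReal (∫ x, ‖∇ (φ k : EuclideanSpace ℝ (Fin N) → ℝ) x‖ ^ 2)) atTop
        (𝓝 (∫⁻ x in Ω, ENNReal.ofReal (‖g x‖ ^ 2))) := by
  obtain ⟨φ, h1, h2⟩ := h.approx
  have h3 : TendstoInMeasure (volume.restrict (Ω : Set (EuclideanSpace ℝ (Fin N))))
      (fun k => (φ k : EuclideanSpace ℝ (Fin N) → ℝ)) atTop u :=
    tendstoInMeasure_of_tendsto_eLpNorm hp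
      (fun k => (φ k).continuous.aestronglyMeasurable) h.memLp.1 h1
  obtain ⟨σ, hσ, h4⟩ := h3.exists_seq_tendsto_ae
  refine ⟨fun k => φ (σ k), h4, ?_⟩
  simp_rw [← setLIntegral_gradient_sq]
  exact (tendsto_lintegral_norm_sq (fun k => (memLp_gradient (φ k) 2 _).1) h.memLp_grad h2).comp
    hσ.tendsto_atTop

lemma lintegral_mul_sq_le_liminf {W u : EuclideanSpace ℝ (Fin N) → ℝ} (hWm : Measurable W)
    {φ : ℕ → EuclideanSpace ℝ (Fin N) → ℝ} (hφ : ∀ k, Continuous (φ k))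
    {ν : Measure (EuclideanSpace ℝ (Fin N))}
    (h : ∀ᵐ x ∂ν, Tendsto (fun k => φ k x) atTop (𝓝 (u x))) :
    ∫⁻ x, ENNReal.ofReal (W x * u x ^ 2) ∂ν ≤
      liminf (fun k => ∫⁻ x, ENNReal.ofReal (W x * φ k x ^ 2) ∂ν) atTop := by
  have h1 : ∀ᵐ x ∂ν, ENNReal.ofReal (W x * u x ^ 2) =
      liminf (fun k => ENNReal.ofReal (W x * φ k x ^ 2)) atTop := by
    filter_upwards [h] with x hx
    exact (ENNReal.tendsto_ofReal ((hx.pow 2).const_mul (W x))).liminf_eq.symm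
  rw [lintegral_congr_ae h1]
  refine lintegral_liminf_le fun k => ?_
  have := (hφ k).measurable
  fun_prop

end Closure

end

end MultipolarHardy

/-! ### The optimal constant, and non-attainment for two poles -/

namespace MultipolarHardy

noncomputable section

variable {N n : ℕ} {Ω : Opens (EuclideanSpace ℝ (Fin N))}

lemma sobolevExponent_ne_zero (hN : 3 ≤ N) : ENNReal.ofReal (2 * N / (N - 2)) ≠ 0 := by
  have hN' : (3 : ℝ) ≤ N := by exact_mod_cast hN
  rw [ENNReal.ofReal_ne_zero_iff]
  exact div_pos (by linarith) (by linarith)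

lemma hardyConstant_le_testFunction (hN : 3 ≤ N) (a : Fin n → EuclideanSpace ℝ (Fin N))
    (φ : 𝓓(Ω, ℝ)) (hφ : 0 < ∫ x, potential a x * φ x ^ 2) :
    hardyConstant a Ω ≤ ENNReal.ofReal
      ((∫ x, ‖∇ (φ : EuclideanSpace ℝ (Fin N) → ℝ) x‖ ^ 2) / ∫ x, potential a x * φ x ^ 2) := by
  refine sInf_le ⟨φ, ∇ (φ : EuclideanSpace ℝ (Fin N) → ℝ), memClosure_testFunction φ _, ?_, ?_⟩
  · intro h
    rw [← setIntegral_mul_sq] at hφ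
    have h1 : ∫ x in Ω, potential a x * φ x ^ 2 = 0 := by
      refine integral_eq_zero_of_ae ?_
      filter_upwards [h] with x hx
      simp [hx]
    exact hφ.ne' h1
  · rw [hardyQuotient, setLIntegral_gradient_sq, setLIntegral_mul_sq φ (potential_nonneg a)
      (integrable_potential_mul_testFunction_sq hN a φ), ENNReal.ofReal_div_of_pos hφ]

lemma toReal_hardyConstant_mul_le (hN : 3 ≤ N) (a : Fin n → EuclideanSpace ℝ (Fin N))
    (φ : 𝓓(Ω, ℝ)) :
    (hardyConstant a Ω).toReal * (∫ x, potential a x * φ x ^ 2) ≤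
      ∫ x, ‖∇ (φ : EuclideanSpace ℝ (Fin N) → ℝ) x‖ ^ 2 := by
  have hG : 0 ≤ ∫ x, ‖∇ (φ : EuclideanSpace ℝ (Fin N) → ℝ) x‖ ^ 2 :=
    integral_nonneg fun x => by positivity
  have hP : 0 ≤ ∫ x, potential a x * φ x ^ 2 :=
    integral_nonneg fun x => mul_nonneg (potential_nonneg a x) (sq_nonneg _)
  rcases hP.eq_or_lt with h0 | h0
  · rw [← h0, mul_zero]; exact hG
  · rw [← le_div_iff₀ h0]
    exact ENNReal.toReal_le_of_le_ofReal (by positivity) (hardyConstant_le_testFunction hN a φ h0)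

lemma threshold_pos (hN : 3 ≤ N) (hn : 2 ≤ n) : 0 < ((N : ℝ) - 2) ^ 2 / (4 * n - 4) := by
  have hN' : (3 : ℝ) ≤ N := by exact_mod_cast hN
  have hn' : (2 : ℝ) ≤ n := by exact_mod_cast hn
  exact div_pos (by nlinarith) (by linarith)

lemma hardyConstant_le_threshold (hN : 3 ≤ N) (hn : 2 ≤ n)
    (a : Fin n → EuclideanSpace ℝ (Fin N)) (ha : Function.Injective a) (haΩ : ∀ i, a i ∈ Ω) :
    hardyConstant a Ω ≤ ENNReal.ofReal (((N : ℝ) - 2) ^ 2 / (4 * n - 4)) := by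
  by_contra! hlt
  obtain ⟨μ, hμ0, hμ1, hμ2⟩ := ENNReal.lt_iff_exists_real_btwn.1 hlt
  have hμ : ((N : ℝ) - 2) ^ 2 / (4 * n - 4) < μ := (ENNReal.ofReal_lt_ofReal_iff'.1 hμ1).1
  -- With lower-order constant 0 the inequality says that the quotient of `φ` is below `μ`.
  obtain ⟨φ, hφ⟩ := exists_lt_above_threshold hN hn Ω a ha haΩ hμ 0
  rw [zero_mul, zero_add] at hφ
  have hG : 0 ≤ ∫ x, ‖∇ (φ : EuclideanSpace ℝ (Fin N) → ℝ) x‖ ^ 2 :=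
    integral_nonneg fun x => by positivity
  have hP : 0 < ∫ x, potential a x * φ x ^ 2 := by
    by_contra! h
    nlinarith
  refine absurd (hardyConstant_le_testFunction hN a φ hP) (not_le.2 (lt_of_le_of_lt ?_ hμ2))
  exact ENNReal.ofReal_le_ofReal ((div_le_iff₀ hP).2 hφ.le)

/-- Approximating an element of `D^{1,2}(Ω)`, the gradient energies converge and, by Fatou, the
weighted masses can only drop in the limit; so a nearby test function also has quotient below `q`.
-/
lemma exists_testFunction_lt (hN : 3 ≤ N) (hn : 2 ≤ n) (a : Fin n → EuclideanSpace ℝ (Fin N))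
    (ha : Function.Injective a) {q : ℝ} (hq : hardyConstant a Ω < ENNReal.ofReal q) :
    ∃ φ : 𝓓(Ω, ℝ), 0 < (∫ x, potential a x * φ x ^ 2) ∧
      ∫ x, ‖∇ (φ : EuclideanSpace ℝ (Fin N) → ℝ) x‖ ^ 2 < q * ∫ x, potential a x * φ x ^ 2 := by
  have hq0 : 0 < q := ENNReal.ofReal_pos.1 (bot_le.trans_lt hq)
  obtain ⟨_, ⟨u, g, hug, hu, rfl⟩, hlt⟩ := sInf_lt_iff.1 hq
  rw [hardyQuotient, ENNReal.div_lt_iff _ (Or.inr (lintegral_norm_sq_ne_top hug.memLp_grad))] at hlt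
  swap
  -- The denominator is nonzero because `V > 0` almost everywhere.
  · refine Or.inl fun h0 => hu ?_
    rw [lintegral_eq_zero_iff'] at h0
    · filter_upwards [h0, ae_restrict_of_ae (ae_notMem_range hN a)] with x hx hxa
      have h1 := potential_pos hn a ha hxa
      have h2 : potential a x * u x ^ 2 ≤ 0 := ENNReal.ofReal_eq_zero.1 hx
      have h3 : u x ^ 2 ≤ 0 := by
        by_contra! h
        nlinarith [mul_pos h1 h]
      exact pow_eq_zero_iff two_ne_zero |>.1 (le_antisymm h3 (sq_nonneg _))
    · exact ENNReal.measurable_ofReal.comp_aemeasurable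
        ((measurable_potential a).aemeasurable.mul (hug.memLp.1.aemeasurable.pow_const 2))
  obtain ⟨φ, hφ1, hφ2⟩ := hug.exists_seq (sobolevExponent_ne_zero hN)
  have hfatou := lintegral_mul_sq_le_liminf (measurable_potential a)
    (fun k => (φ k).continuous) hφ1
  have e : ∀ k, ∫⁻ x in Ω, ENNReal.ofReal (potential a x * φ k x ^ 2) =
      ENNReal.ofReal (∫ x, potential a x * φ k x ^ 2) := fun k =>
    setLIntegral_mul_sq _ (potential_nonneg a) (integrable_potential_mul_testFunction_sq hN a _)
  simp_rw [e] at hfatou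
  have hlt2 := (ENNReal.div_lt_iff (Or.inl (ENNReal.ofReal_pos.2 hq0).ne')
    (Or.inl ENNReal.ofReal_ne_top)).2 (mul_comm (ENNReal.ofReal q) _ ▸ hlt)
  obtain ⟨c, hc1, hc2⟩ := exists_between (hlt2.trans_le hfatou)
  have h1 := eventually_lt_of_lt_liminf hc2
  have h2 := hφ2.eventually_lt_const ((ENNReal.div_lt_iff (Or.inl (ENNReal.ofReal_pos.2 hq0).ne')
    (Or.inl ENNReal.ofReal_ne_top)).1 hc1)
  obtain ⟨k, hk1, hk2⟩ := (h1.and h2).exists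
  have h3 : ENNReal.ofReal (∫ x, ‖∇ (φ k : EuclideanSpace ℝ (Fin N) → ℝ) x‖ ^ 2) <
      ENNReal.ofReal (q * ∫ x, potential a x * φ k x ^ 2) := by
    rw [ENNReal.ofReal_mul hq0.le, mul_comm]
    exact hk2.trans_le (by gcongr)
  refine ⟨φ k, ENNReal.ofReal_pos.1 (bot_le.trans_lt hk1), ?_⟩
  exact (ENNReal.ofReal_lt_ofReal_iff'.1 h3).1

/-- For two poles the optimal constant is not attained. -/
theorem not_attained_two_poles (hN : 3 ≤ N)
    (hΩ : Bornology.IsBounded (Ω : Set (EuclideanSpace ℝ (Fin N))))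
    (a : Fin 2 → EuclideanSpace ℝ (Fin N)) (ha : Function.Injective a) (haΩ : ∀ i, a i ∈ Ω)
    {u : EuclideanSpace ℝ (Fin N) → ℝ} {g : EuclideanSpace ℝ (Fin N) → EuclideanSpace ℝ (Fin N)}
    (hug : MemD12 Ω u g) (heq : hardyQuotient a Ω u g = hardyConstant a Ω) :
    u =ᵐ[volume.restrict (Ω : Set (EuclideanSpace ℝ (Fin N)))] 0 := by
  obtain ⟨δ, e, hδ, he, hrem⟩ := exists_two_pole_hardy_remainder hN a hΩ
  set α : ℝ := ((N : ℝ) - 2) / 2 with hα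
  have hα0 : 0 < α := by
    have hN' : (3 : ℝ) ≤ N := by exact_mod_cast hN
    rw [hα]; linarith
  have hle : hardyQuotient a Ω u g ≤ ENNReal.ofReal (α ^ 2) := by
    rw [heq]
    refine (hardyConstant_le_threshold hN le_rfl a ha haΩ).trans (le_of_eq ?_)
    congr 1; rw [hα]; push_cast; ring
  rw [hardyQuotient, ENNReal.div_le_iff_le_mul (Or.inr ENNReal.ofReal_ne_top)
    (Or.inr (ENNReal.ofReal_pos.2 (by positivity)).ne')] at hle
  set T : EuclideanSpace ℝ (Fin N) → ℝ := fun x => inner ℝ e (x - a 0) ^ (2 * N) with hT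
  have hT0 : ∀ x, 0 ≤ T x := fun x => by simp only [hT]; rw [pow_mul]; positivity
  have hTm : Measurable T := (by fun_prop : Continuous T).measurable
  have hVm := measurable_potential a
  have hV0 := potential_nonneg a
  have hum : AEMeasurable u (volume.restrict (Ω : Set (EuclideanSpace ℝ (Fin N)))) :=
    hug.memLp.1.aemeasurable
  obtain ⟨φ, hφ1, hφ2⟩ := hug.exists_seq (sobolevExponent_ne_zero hN)
  have hfatou := lintegral_mul_sq_le_liminf (W := fun x => α ^ 2 * potential a x + δ * T x)
    (by fun_prop) (fun k => (φ k).continuous) hφ1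
  have hk : ∀ k, ∫⁻ x in Ω, ENNReal.ofReal ((α ^ 2 * potential a x + δ * T x) * φ k x ^ 2) ≤
      ENNReal.ofReal (∫ x, ‖∇ (φ k : EuclideanSpace ℝ (Fin N) → ℝ) x‖ ^ 2) := by
    intro k
    have i1 := integrable_potential_mul_testFunction_sq hN a (φ k)
    have i2 : Integrable (fun x => T x * φ k x ^ 2) :=
      Continuous.integrable_of_hasCompactSupport (by fun_prop)
        (hasCompactSupport_sq (φ k).hasCompactSupport).mul_left
    have e1 : ∀ x, (α ^ 2 * potential a x + δ * T x) * φ k x ^ 2 =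
        α ^ 2 * (potential a x * φ k x ^ 2) + δ * (T x * φ k x ^ 2) := fun x => by ring
    rw [setLIntegral_mul_sq (φ k)
      (fun x => add_nonneg (mul_nonneg (sq_nonneg _) (hV0 x)) (mul_nonneg hδ.le (hT0 x)))]
    · refine ENNReal.ofReal_le_ofReal ?_
      simp_rw [e1]
      rw [integral_add (i1.const_mul _) (i2.const_mul _), integral_const_mul, integral_const_mul]
      exact hrem (φ k) (contDiff_one _) (φ k).hasCompactSupport (support_subset _)
    · simp_rw [e1]
      exact (i1.const_mul _).add (i2.const_mul _)
  have h1 : ∫⁻ x in Ω, ENNReal.ofReal ((α ^ 2 * potential a x + δ * T x) * u x ^ 2) ≤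
      ∫⁻ x in Ω, ENNReal.ofReal (‖g x‖ ^ 2) := by
    rw [← hφ2.liminf_eq]
    exact hfatou.trans (liminf_le_liminf (Eventually.of_forall hk))
  have e2 : ∀ x, ENNReal.ofReal ((α ^ 2 * potential a x + δ * T x) * u x ^ 2) =
      ENNReal.ofReal (α ^ 2) * ENNReal.ofReal (potential a x * u x ^ 2) +
        ENNReal.ofReal (δ * (T x * u x ^ 2)) := by
    intro x
    rw [← ENNReal.ofReal_mul (by positivity), ← ENNReal.ofReal_add]
    · congr 1; ring
    · exact mul_nonneg (sq_nonneg _) (mul_nonneg (hV0 x) (sq_nonneg _))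
    · exact mul_nonneg hδ.le (mul_nonneg (hT0 x) (sq_nonneg _))
  simp_rw [e2] at h1
  have hTum : AEMeasurable (fun x => ENNReal.ofReal (δ * (T x * u x ^ 2)))
      (volume.restrict (Ω : Set (EuclideanSpace ℝ (Fin N)))) :=
    ENNReal.measurable_ofReal.comp_aemeasurable
      ((hTm.aemeasurable.mul (hum.pow_const 2)).const_mul δ)
  rw [lintegral_add_right' _ hTum, lintegral_const_mul' _ _ ENNReal.ofReal_ne_top] at h1
  have hfin : ∫⁻ x in Ω, ENNReal.ofReal (‖g x‖ ^ 2) ≠ ∞ :=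
    lintegral_norm_sq_ne_top hug.memLp_grad
  -- The energy is at least `α² ∫ V u²` plus the remainder and at most `α² ∫ V u²`, which is finite
  -- and can be cancelled.
  have h2 : ∫⁻ x in Ω, ENNReal.ofReal (δ * (T x * u x ^ 2)) = 0 := by
    have hfin2 := ne_top_of_le_ne_top hfin (le_self_add.trans h1)
    have h3 := h1.trans hle
    nth_rewrite 2 [← add_zero (ENNReal.ofReal (α ^ 2) * _)] at h3
    exact le_antisymm ((ENNReal.add_le_add_iff_left hfin2).1 h3) bot_le
  rw [lintegral_eq_zero_iff' hTum] at h2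
  -- The weight `T` vanishes only on an affine hyperplane, a null set.
  have hnull : ∀ᵐ x : EuclideanSpace ℝ (Fin N), inner ℝ e (x - a 0) ≠ 0 := by
    have h3 : volume {x : EuclideanSpace ℝ (Fin N) | inner ℝ e x = 0} = 0 := by
      refine (Measure.addHaar_submodule volume (LinearMap.ker (innerSL ℝ e).toLinearMap)
        fun htop => ?_)
      have : e ∈ LinearMap.ker (innerSL ℝ e).toLinearMap := htop ▸ Submodule.mem_top
      have h4 : inner ℝ e e = 0 := this
      rw [real_inner_self_eq_norm_sq, he] at h4
      norm_num at h4
    have h4 := (measurePreserving_sub_right volume (a 0)).quasiMeasurePreserving.ae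
      (p := fun x => inner ℝ e x ≠ 0) (by simpa [ae_iff] using h3)
    exact h4
  filter_upwards [h2, ae_restrict_of_ae hnull] with x hx hx0
  have h3 : δ * (T x * u x ^ 2) ≤ 0 := ENNReal.ofReal_eq_zero.1 hx
  have h4 : 0 < T x := lt_of_le_of_ne (hT0 x) (pow_ne_zero _ hx0).symm
  by_contra hne
  have h5 : 0 < u x ^ 2 := by
    have : u x ≠ 0 := hne
    positivity
  have : 0 < δ * (T x * u x ^ 2) := by positivity
  linarith

end

end MultipolarHardy

/-! ### Existence of a minimiser below the threshold -/

namespace MultipolarHardy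

noncomputable section

variable {N n : ℕ} {Ω : Opens (EuclideanSpace ℝ (Fin N))}

lemma integral_gradient_parallelogram (φ ψ : 𝓓(Ω, ℝ)) :
    (∫ x, ‖∇ ((φ + ψ : 𝓓(Ω, ℝ)) : EuclideanSpace ℝ (Fin N) → ℝ) x‖ ^ 2) +
      (∫ x, ‖∇ ((φ - ψ : 𝓓(Ω, ℝ)) : EuclideanSpace ℝ (Fin N) → ℝ) x‖ ^ 2) =
    2 * (∫ x, ‖∇ (φ : EuclideanSpace ℝ (Fin N) → ℝ) x‖ ^ 2) +
      2 * ∫ x, ‖∇ (ψ : EuclideanSpace ℝ (Fin N) → ℝ) x‖ ^ 2 := by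
  have hi : ∀ χ : 𝓓(Ω, ℝ), Integrable fun x => ‖∇ (χ : EuclideanSpace ℝ (Fin N) → ℝ) x‖ ^ 2 :=
    fun χ => integrable_norm_gradient_sq (contDiff_one χ) χ.hasCompactSupport
  rw [← integral_add (hi _) (hi _), ← integral_const_mul, ← integral_const_mul,
    ← integral_add ((hi _).const_mul _) ((hi _).const_mul _)]
  refine integral_congr_ae (Eventually.of_forall fun x => ?_)
  simp only
  rw [gradient_coe_add, gradient_coe_sub]
  linarith [parallelogram_law_with_norm ℝ (∇ (φ : EuclideanSpace ℝ (Fin N) → ℝ) x)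
    (∇ (ψ : EuclideanSpace ℝ (Fin N) → ℝ) x)]

lemma integral_potential_parallelogram (hN : 3 ≤ N) (a : Fin n → EuclideanSpace ℝ (Fin N))
    (φ ψ : 𝓓(Ω, ℝ)) :
    (∫ x, potential a x * (φ + ψ) x ^ 2) + (∫ x, potential a x * (φ - ψ) x ^ 2) =
    2 * (∫ x, potential a x * φ x ^ 2) + 2 * ∫ x, potential a x * ψ x ^ 2 := by
  have hi := integrable_potential_mul_testFunction_sq (Ω := Ω) hN a
  rw [← integral_add (hi _) (hi _), ← integral_const_mul, ← integral_const_mul,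
    ← integral_add ((hi _).const_mul _) ((hi _).const_mul _)]
  refine integral_congr_ae (Eventually.of_forall fun x => ?_)
  have h1 : (φ + ψ) x = φ x + ψ x := rfl
  have h2 : (φ - ψ) x = φ x - ψ x := rfl
  simp only [h1, h2]
  ring

/-- A minimizing sequence of test functions that is Cauchy in `L²`. -/
lemma exists_minimizing_seq (hN : 3 ≤ N) (hn : 2 ≤ n)
    (hΩ : Bornology.IsBounded (Ω : Set (EuclideanSpace ℝ (Fin N))))
    (a : Fin n → EuclideanSpace ℝ (Fin N)) (ha : Function.Injective a)
    (hfin : hardyConstant a Ω ≠ ∞) :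
    ∃ χ : ℕ → 𝓓(Ω, ℝ), (∀ k, ∫ x, potential a x * χ k x ^ 2 = 1) ∧
      (∀ k, ∫ x, ‖∇ (χ k : EuclideanSpace ℝ (Fin N) → ℝ) x‖ ^ 2 ≤
        (hardyConstant a Ω).toReal + 1 / ((k : ℝ) + 1)) ∧
      ∀ ε > 0, ∃ K, ∀ j ≥ K, ∀ k ≥ K, ∫ x, (χ j - χ k) x ^ 2 < ε := by
  set m : ℝ := (hardyConstant a Ω).toReal with hm
  have hm0 : 0 ≤ m := ENNReal.toReal_nonneg
  have hψ : ∀ k : ℕ, ∃ ψ : 𝓓(Ω, ℝ), ∫ x, potential a x * ψ x ^ 2 = 1 ∧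
      ∫ x, ‖∇ (ψ : EuclideanSpace ℝ (Fin N) → ℝ) x‖ ^ 2 ≤ m + 1 / ((k : ℝ) + 1) := by
    intro k
    have hq : hardyConstant a Ω < ENNReal.ofReal (m + 1 / ((k : ℝ) + 1)) := by
      rw [ENNReal.lt_ofReal_iff_toReal_lt hfin, ← hm]
      have : 0 < 1 / ((k : ℝ) + 1) := by positivity
      linarith
    obtain ⟨φ, hφ1, hφ2⟩ := exists_testFunction_lt hN hn a ha hq
    set P := ∫ x, potential a x * φ x ^ 2
    have hc : (Real.sqrt P)⁻¹ ^ 2 = P⁻¹ := by rw [inv_pow, Real.sq_sqrt hφ1.le]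
    refine ⟨(Real.sqrt P)⁻¹ • φ, ?_, ?_⟩
    · have e : ∀ x, potential a x * ((Real.sqrt P)⁻¹ • φ) x ^ 2 =
          P⁻¹ * (potential a x * φ x ^ 2) := fun x => by
        have h1 : ((Real.sqrt P)⁻¹ • φ) x = (Real.sqrt P)⁻¹ * φ x := rfl
        rw [h1, mul_pow, hc]; ring
      simp_rw [e]
      rw [integral_const_mul]
      exact inv_mul_cancel₀ hφ1.ne'
    · simp_rw [gradient_smul, norm_smul, mul_pow, Real.norm_eq_abs, sq_abs, hc]
      rw [integral_const_mul, inv_mul_le_iff₀ hφ1, mul_comm]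
      exact hφ2.le
  choose ψ hψ1 hψ2 using hψ
  obtain ⟨C, hC, hpoin⟩ := exists_integral_sq_le hN hn a ha hΩ
  have hG : ∀ k, ∫ x, ‖∇ (ψ k : EuclideanSpace ℝ (Fin N) → ℝ) x‖ ^ 2 ≤ m + 1 := fun k => by
    refine (hψ2 k).trans ?_
    gcongr
    rw [div_le_one (by positivity)]
    linarith [(Nat.cast_nonneg k : (0 : ℝ) ≤ k)]
  obtain ⟨σ, hσ, hcau⟩ := exists_subseq_cauchy_sq hΩ
    (fun k => (ψ k : EuclideanSpace ℝ (Fin N) → ℝ)) (fun k => contDiff_one _)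
    (fun k => (ψ k).hasCompactSupport) (fun k => support_subset _) (M := max (C * (m + 1)) (m + 1))
    (fun k => ((hpoin _ (contDiff_one _) (ψ k).hasCompactSupport (support_subset _)).trans
      (mul_le_mul_of_nonneg_left (hG k) hC)).trans (le_max_left _ _))
    (fun k => (hG k).trans (le_max_right _ _))
  refine ⟨fun k => ψ (σ k), fun k => hψ1 _, fun k => (hψ2 _).trans ?_, hcau⟩
  gcongr
  exact_mod_cast hσ.le_apply

/-- Below the threshold the optimal constant is attained in `H¹₀`. -/
theorem exists_minimizer (hN : 3 ≤ N) (hn : 2 ≤ n)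
    (hΩ : Bornology.IsBounded (Ω : Set (EuclideanSpace ℝ (Fin N))))
    (a : Fin n → EuclideanSpace ℝ (Fin N)) (ha : Function.Injective a)
    (hlt : hardyConstant a Ω < ENNReal.ofReal (((N : ℝ) - 2) ^ 2 / (4 * n - 4))) :
    ∃ u g, MemH10 Ω u g ∧
      ¬ u =ᵐ[volume.restrict (Ω : Set (EuclideanSpace ℝ (Fin N)))] 0 ∧
      hardyQuotient a Ω u g = hardyConstant a Ω := by
  have hfin : hardyConstant a Ω ≠ ∞ := hlt.ne_top
  obtain ⟨χ, hP1, hGm, hcau⟩ := exists_minimizing_seq hN hn hΩ a ha hfin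
  set m : ℝ := (hardyConstant a Ω).toReal with hm
  have hm0 : 0 ≤ m := ENNReal.toReal_nonneg
  have hmlt : m < ((N : ℝ) - 2) ^ 2 / (4 * n - 4) := (ENNReal.lt_ofReal_iff_toReal_lt hfin).1 hlt
  -- The gap `μ - m` is the coercivity constant for the gradient norm.
  obtain ⟨μ, hμ1, hμ2⟩ := exists_between hmlt
  obtain ⟨c, hc, hweak⟩ := weak_hardy hN hn a ha hμ2
  have hQ : ∀ φ : 𝓓(Ω, ℝ), m * (∫ x, potential a x * φ x ^ 2) ≤
    ∫ x, ‖∇ (φ : EuclideanSpace ℝ (Fin N) → ℝ) x‖ ^ 2 := toReal_hardyConstant_mul_le hN a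
  -- the sequence is Cauchy for the gradient norm
  have hgrad : ∀ ε > 0, ∃ K, ∀ j ≥ K, ∀ k ≥ K,
      ∫ x, ‖∇ ((χ j - χ k : 𝓓(Ω, ℝ)) : EuclideanSpace ℝ (Fin N) → ℝ) x‖ ^ 2 < ε := by
    intro ε hε
    have hd : 0 < (μ - m) * ε := mul_pos (by linarith) hε
    have hμ0 : 0 < μ := by linarith
    -- The `+ 1` guards against `m * c = 0`.
    obtain ⟨K₁, hK₁⟩ := hcau ((μ - m) * ε / 2 / (m * c + 1)) (by positivity)
    obtain ⟨K₂, hK₂⟩ := exists_nat_one_div_lt (show 0 < (μ - m) * ε / (8 * μ) by positivity)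
    refine ⟨max K₁ K₂, fun j hj k hk => ?_⟩
    have h1 := hK₁ j ((le_max_left _ _).trans hj) k ((le_max_left _ _).trans hk)
    have hsmall : ∀ i ≥ max K₁ K₂, 1 / ((i : ℝ) + 1) < (μ - m) * ε / (8 * μ) := fun i hi => by
      refine lt_of_le_of_lt ?_ hK₂
      gcongr
      exact_mod_cast (le_max_right _ _).trans hi
    have h2 := integral_gradient_parallelogram (χ j) (χ k)
    have h3 := integral_potential_parallelogram hN a (χ j) (χ k)
    have h4 := hQ (χ j + χ k)
    have h5 := hweak (χ j - χ k : 𝓓(Ω, ℝ)) (contDiff_one _) (χ j - χ k).hasCompactSupport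
    rw [hP1, hP1] at h3
    set G := ∫ x, ‖∇ ((χ j - χ k : 𝓓(Ω, ℝ)) : EuclideanSpace ℝ (Fin N) → ℝ) x‖ ^ 2
    set P := ∫ x, potential a x * (χ j - χ k) x ^ 2
    set S := ∫ x, (χ j - χ k) x ^ 2
    have hS0 : 0 ≤ S := integral_nonneg fun x => sq_nonneg _
    -- By the parallelogram law, the form `∫ |∇·|² - m ∫ V ·²` at `χ j - χ k` is at most twice the
    -- sum of its values at `χ j` and `χ k`, since it is nonnegative at `χ j + χ k`.
    have h6 : G - m * P ≤ (μ - m) * ε / (2 * μ) := by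
      have e : (μ - m) * ε / (2 * μ) = 4 * ((μ - m) * ε / (8 * μ)) := by field_simp; ring
      rw [e]
      have e1 : ∫ x, potential a x * (χ j + χ k) x ^ 2 = 4 - P := by linarith
      rw [e1] at h4
      linarith [hGm j, hGm k, hsmall j hj, hsmall k hk]
    have h7 : m * c * S < (μ - m) * ε / 2 := by
      rw [lt_div_iff₀ (by positivity)] at h1
      nlinarith
    have h8 : μ * (G - m * P) ≤ (μ - m) * ε / 2 := by
      have := mul_le_mul_of_nonneg_left h6 hμ0.le
      have e : μ * ((μ - m) * ε / (2 * μ)) = (μ - m) * ε / 2 := by field_simp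
      linarith
    have h9 := mul_le_mul_of_nonneg_left h5 hm0
    -- Substituting `μ P ≤ c S + G` into `μ G ≤ μ m P + (μ - m) ε / 2` leaves `(μ - m) G ≤ m c S +
    -- (μ - m) ε / 2`.
    have h10 : (μ - m) * G < (μ - m) * ε := by nlinarith
    exact lt_of_mul_lt_mul_left h10 (by linarith)
  -- passage to the limit
  set ν := volume.restrict (Ω : Set (EuclideanSpace ℝ (Fin N))) with hν
  obtain ⟨u, hu, hulim⟩ := exists_limit_of_cauchy_sq (ν := ν)
    (fun k => memLp_testFunction (χ k) 2 ν) (by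
      intro ε hε
      obtain ⟨K, hK⟩ := hcau ε hε
      refine ⟨K, fun j hj k hk => ?_⟩
      have h1 := hK j hj k hk
      rw [← setIntegral_sq] at h1
      simpa [sq_abs] using h1)
  obtain ⟨g, hg, hglim⟩ := exists_limit_of_cauchy_sq (ν := ν)
    (fun k => memLp_gradient (χ k) 2 ν) (by
      intro ε hε
      obtain ⟨K, hK⟩ := hgrad ε hε
      refine ⟨K, fun j hj k hk => ?_⟩
      have h1 := hK j hj k hk
      rw [← setIntegral_gradient_sq] at h1
      simpa only [gradient_coe_sub] using h1)
  have hGg : ∫⁻ x in Ω, ENNReal.ofReal (‖g x‖ ^ 2) = hardyConstant a Ω := by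
    have h1 := tendsto_lintegral_norm_sq (fun k => (memLp_gradient (χ k) 2 ν).1) hg hglim
    refine tendsto_nhds_unique h1 ?_
    simp_rw [hν, setLIntegral_gradient_sq]
    rw [← ENNReal.ofReal_toReal hfin, ← hm]
    refine ENNReal.tendsto_ofReal ?_
    refine tendsto_of_tendsto_of_tendsto_of_le_of_le tendsto_const_nhds
      (by simpa using tendsto_one_div_add_atTop_nhds_zero_nat.const_add m) (fun k => ?_) hGm
    have := hQ (χ k)
    rw [hP1, mul_one] at this
    exact this
  have hVm := measurable_potential a
  set A : ℝ := (((N : ℝ) - 2) / n) ^ 2 with hA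
  have hA0 : 0 < A := by
    have hN' : (3 : ℝ) ≤ N := by exact_mod_cast hN
    have hn' : (2 : ℝ) ≤ n := by exact_mod_cast hn
    have : 0 < ((N : ℝ) - 2) / n := div_pos (by linarith) (by linarith)
    positivity
  obtain ⟨σ, hσ, hae⟩ := (tendstoInMeasure_of_tendsto_eLpNorm (two_ne_zero)
      (fun k => (χ k).continuous.aestronglyMeasurable) hu.1 hulim).exists_seq_tendsto_ae
  -- convergence in the norm with weight `V`
  set f : ℕ → EuclideanSpace ℝ (Fin N) → ℝ := fun k x => Real.sqrt (potential a x) * χ k x with hf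
  set f' : EuclideanSpace ℝ (Fin N) → ℝ := fun x => Real.sqrt (potential a x) * u x with hf'
  have hsq : ∀ x y : ℝ, ∀ z, ‖Real.sqrt (potential a z) * x - Real.sqrt (potential a z) * y‖ ^ 2 =
      potential a z * (x - y) ^ 2 := fun x y z => by
    rw [← mul_sub, norm_mul, mul_pow, Real.norm_eq_abs, Real.norm_eq_abs, sq_abs, sq_abs,
      Real.sq_sqrt (potential_nonneg a z)]
  have hsq' : ∀ x : ℝ, ∀ z, ‖Real.sqrt (potential a z) * x‖ ^ 2 = potential a z * x ^ 2 :=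
    fun x z => by simpa using hsq x 0 z
  have hfm : ∀ k, AEStronglyMeasurable (f k) ν := fun k => by
    have := (χ k).continuous.measurable
    exact (by fun_prop : Measurable (f k)).aestronglyMeasurable
  have hfm' : AEStronglyMeasurable f' ν :=
    (by fun_prop : Measurable fun x => Real.sqrt (potential a x)).aestronglyMeasurable.mul hu.1
  have hf'mem : MemLp f' 2 ν := by
    refine ⟨hfm', ?_⟩
    have h1 := lintegral_mul_sq_le_liminf hVm (fun k => (χ (σ k)).continuous) hae
    have h2 : ∀ k, ∫⁻ x, ENNReal.ofReal (potential a x * χ (σ k) x ^ 2) ∂ν = 1 := fun k => by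
      rw [hν, setLIntegral_mul_sq _ (potential_nonneg a)
        (integrable_potential_mul_testFunction_sq hN a _), hP1, ENNReal.ofReal_one]
    simp_rw [h2, liminf_const] at h1
    simp_rw [← hsq', ← eLpNorm_two_sq] at h1
    by_contra h
    rw [not_lt, top_le_iff] at h
    have h3 : eLpNorm f' 2 ν ^ 2 ≤ 1 := h1
    simp [h] at h3
  -- For fixed `k`, Fatou in `j` bounds the weighted norm of `χ k - u` by that of `χ k - χ (σ j)`,
  -- which `multipolar_hardy` controls by the gradient. No mass is lost, so the constraint survives
  -- in the limit.
  have hflim : Tendsto (fun k => eLpNorm (fun x => f k x - f' x) 2 ν) atTop (𝓝 0) := by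
    have h1 : Tendsto (fun k => eLpNorm (fun x => f k x - f' x) 2 ν ^ 2) atTop (𝓝 0) := by
      rw [ENNReal.tendsto_nhds_zero]
      intro ε hε
      obtain ⟨r, hr0, hr⟩ : ∃ r : ℝ, 0 < r ∧ ENNReal.ofReal r ≤ ε := by
        obtain ⟨r, -, hr1, hr2⟩ := ENNReal.lt_iff_exists_real_btwn.1 hε
        exact ⟨r, ENNReal.ofReal_pos.1 hr1, hr2.le⟩
      obtain ⟨K, hK⟩ := hgrad (A * r) (by positivity)
      filter_upwards [eventually_ge_atTop K] with k hk
      have h2 := lintegral_mul_sq_le_liminf (ν := ν) (u := fun x => χ k x - u x)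
        (φ := fun j x => χ k x - χ (σ j) x) hVm (fun j => by fun_prop)
        (by filter_upwards [hae] with x hx using hx.const_sub _)
      rw [eLpNorm_two_sq]
      simp_rw [hf, hf', hsq]
      refine (h2.trans ?_).trans hr
      refine liminf_le_of_frequently_le' (Eventually.frequently ?_)
      filter_upwards [eventually_ge_atTop K] with j hj
      have h3 := hK k hk (σ j) (hj.trans hσ.le_apply)
      have h4 := multipolar_hardy hN hn a (contDiff_one (χ k - χ (σ j)))
        (χ k - χ (σ j)).hasCompactSupport
      have h5 := setLIntegral_mul_sq (χ k - χ (σ j)) (potential_nonneg a)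
        (integrable_potential_mul_testFunction_sq hN a _)
      refine le_trans (le_of_eq h5) (ENNReal.ofReal_le_ofReal ?_)
      rw [← hA] at h4
      exact le_of_mul_le_mul_left (h4.trans h3.le) hA0
    have h2 := h1.ennrpow_const (1 / 2 : ℝ)
    have h3 : ∀ y : ℝ≥0∞, (y ^ 2) ^ (1 / 2 : ℝ) = y := fun y => by
      rw [← ENNReal.rpow_natCast, ← ENNReal.rpow_mul]; norm_num
    simpa only [h3, ENNReal.zero_rpow_of_pos (by norm_num : (0 : ℝ) < 1 / 2)] using h2
  have hPu : ∫⁻ x in Ω, ENNReal.ofReal (potential a x * u x ^ 2) = 1 := by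
    have h1 := tendsto_lintegral_norm_sq hfm hf'mem hflim
    simp_rw [hf, hf', hsq'] at h1
    refine tendsto_nhds_unique h1 ?_
    have h2 : ∀ k, ∫⁻ x, ENNReal.ofReal (potential a x * χ k x ^ 2) ∂ν = 1 := fun k => by
      rw [hν, setLIntegral_mul_sq _ (potential_nonneg a)
        (integrable_potential_mul_testFunction_sq hN a _), hP1, ENNReal.ofReal_one]
    simp_rw [h2]
    exact tendsto_const_nhds
  refine ⟨u, g, ⟨hu, hg, χ, hulim, hglim⟩, fun h0 => ?_, ?_⟩
  · have h1 : ∫⁻ x in Ω, ENNReal.ofReal (potential a x * u x ^ 2) = 0 := by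
      rw [lintegral_congr_ae (g := fun _ => 0), lintegral_zero]
      filter_upwards [h0] with x hx
      simp [hx]
    rw [hPu] at h1
    exact one_ne_zero h1
  · rw [hardyQuotient, hPu, hGg, div_one]

end

end MultipolarHardy

/-! ### Assembly of the theorem -/

theorem theorem2 {N n : ℕ} (hN : 3 ≤ N) (hn : 2 ≤ n)
    (Ω : Opens (EuclideanSpace ℝ (Fin N)))
    (hΩ : Bornology.IsBounded (Ω : Set (EuclideanSpace ℝ (Fin N))))
    (a : Fin n → EuclideanSpace ℝ (Fin N)) (ha : Function.Injective a) (haΩ : ∀ i, a i ∈ Ω) :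
    -- the potential term is finite on `C_0^∞(Ω)`
    (∀ u : 𝓓(Ω, ℝ), IntegrableOn (fun x => MultipolarHardy.potential a x * u x ^ 2) Ω) ∧
    -- below the threshold
    (∀ μ : ℝ, μ < ((N : ℝ) - 2) ^ 2 / (4 * n - 4) → ∃ c : ℝ, ∀ u : 𝓓(Ω, ℝ),
      c * (∫ x in Ω, u x ^ 2) + (∫ x in Ω, ‖∇ (u : EuclideanSpace ℝ (Fin N) → ℝ) x‖ ^ 2) ≥
        μ * ∫ x in Ω, MultipolarHardy.potential a x * u x ^ 2) ∧
    -- above the threshold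
    (∀ μ : ℝ, ((N : ℝ) - 2) ^ 2 / (4 * n - 4) < μ → ∀ c : ℝ, ∃ u : 𝓓(Ω, ℝ),
      c * (∫ x in Ω, u x ^ 2) + (∫ x in Ω, ‖∇ (u : EuclideanSpace ℝ (Fin N) → ℝ) x‖ ^ 2) <
        μ * ∫ x in Ω, MultipolarHardy.potential a x * u x ^ 2) ∧
    -- the weak Hardy constant
    IsLUB (MultipolarHardy.weakHardyParameters a Ω) (((N : ℝ) - 2) ^ 2 / (4 * n - 4)) ∧
    -- attainment in `H¹₀(Ω)` below the threshold
    (MultipolarHardy.hardyConstant a Ω < ENNReal.ofReal (((N : ℝ) - 2) ^ 2 / (4 * n - 4)) →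
      ∃ u g, MultipolarHardy.MemH10 Ω u g ∧
        ¬ u =ᵐ[volume.restrict (Ω : Set (EuclideanSpace ℝ (Fin N)))] 0 ∧
        MultipolarHardy.hardyQuotient a Ω u g = MultipolarHardy.hardyConstant a Ω) ∧
    -- no attainment in `D^{1,2}(Ω)` for two poles
    (n = 2 → ¬ ∃ u g, MultipolarHardy.MemD12 Ω u g ∧
      ¬ u =ᵐ[volume.restrict (Ω : Set (EuclideanSpace ℝ (Fin N)))] 0 ∧
      MultipolarHardy.hardyQuotient a Ω u g = MultipolarHardy.hardyConstant a Ω) := by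
  open MultipolarHardy in
  have below : ∀ μ : ℝ, μ < ((N : ℝ) - 2) ^ 2 / (4 * n - 4) → ∃ c : ℝ, ∀ u : 𝓓(Ω, ℝ),
      c * (∫ x in Ω, u x ^ 2) + (∫ x in Ω, ‖∇ (u : EuclideanSpace ℝ (Fin N) → ℝ) x‖ ^ 2) ≥
        μ * ∫ x in Ω, potential a x * u x ^ 2 := by
    intro μ hμ
    obtain ⟨c, -, hc⟩ := weak_hardy hN hn a ha hμ
    refine ⟨c, fun u => ?_⟩
    rw [setIntegral_sq, setIntegral_gradient_sq, setIntegral_mul_sq]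
    exact hc u (contDiff_one u) u.hasCompactSupport
  have above : ∀ μ : ℝ, ((N : ℝ) - 2) ^ 2 / (4 * n - 4) < μ → ∀ c : ℝ, ∃ u : 𝓓(Ω, ℝ),
      c * (∫ x in Ω, u x ^ 2) + (∫ x in Ω, ‖∇ (u : EuclideanSpace ℝ (Fin N) → ℝ) x‖ ^ 2) <
        μ * ∫ x in Ω, potential a x * u x ^ 2 := by
    intro μ hμ c
    obtain ⟨u, hu⟩ := exists_lt_above_threshold hN hn Ω a ha haΩ hμ c
    refine ⟨u, ?_⟩
    rw [setIntegral_sq, setIntegral_gradient_sq, setIntegral_mul_sq]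
    exact hu
  refine ⟨fun u => (integrable_potential_mul_testFunction_sq hN a u).integrableOn, below, above,
    ⟨?_, ?_⟩, exists_minimizer hN hn hΩ a ha, ?_⟩
  · rintro μ ⟨-, c, hc⟩
    by_contra! hlt
    -- The sign changes because the lower-order term stands on the other side in
    -- `weakHardyParameters`.
    obtain ⟨u, hu⟩ := above μ hlt (-c)
    linarith [hc u]
  · intro b hb
    refine le_of_forall_lt_imp_le_of_dense fun μ hμ => ?_
    -- Parameters are positive by definition, so a nonpositive `μ` is compared with half of the
    -- threshold.
    rcases le_or_gt μ 0 with h0 | h0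
    · have hpos := threshold_pos hN hn
      obtain ⟨c, hc⟩ := below _ (half_lt_self hpos)
      refine h0.trans ((half_pos hpos).le.trans (hb ⟨half_pos hpos, -c, fun u => ?_⟩))
      linarith [hc u]
    · obtain ⟨c, hc⟩ := below μ hμ
      refine hb ⟨h0, -c, fun u => ?_⟩
      linarith [hc u]
  · rintro rfl ⟨u, g, hug, hu, heq⟩
    exact hu (not_attained_two_poles hN hΩ a ha haΩ hug heq)
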